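/- Let $\kappa$ be a finite field with $q$ elements, $\overline{\kappa}$ an algebraic closure, and $\kappa_r\subset\overline{\kappa}$ the extension of $\kappa$ of degree $r$ ($r\ge 1$). All characters take values in $\overline{\mathbb{Q}}$; every multiplicative character $\eta$ (including the trivial one $\varepsilon$) is extended by $\eta(0)=0$, and $\overline{\eta}=\eta^{-1}$. **Character sums.** Let $F$ be a finite field and $\psi$ a non-trivial additive character of $F$. For multiplicative characters of $F$ put $$g(\eta)=-\sum_{x\in F^\times}\psi(x)\eta(x),\qquad g^\circ(\eta)=\begin{cases}\#F\cdot g(\eta)&(\eta=\varepsilon)\\ g(\eta)&(\eta\ne\varepsilon)\end{cases},\qquad (\alpha)_\nu=\frac{g(\alpha\nu)}{g(\alpha)},\qquad (\alpha)^\circ_\nu=\frac{g^\circ(\alpha\nu)}{g^\circ(\alpha)},$$ $$j(\eta_1,\dots,\eta_s)=(-1)^{s-1}\sum_{\substack{x_i\in F^\times\\ x_1+\cdots+x_s=1}}\prod_{i=1}^s\eta_i(x_i),$$ and, for $z_1,\dots,z_n\in F$, $$F_D^{(n)}\Big({\alpha;\beta_1,\dots,\beta_n\atop\gamma};z_1,\dots,z_n\Big)_F=\frac{1}{(1-\#F)^n}\sum_{\nu_1,\dots,\nu_n\in\widehat{F^\times}}\frac{(\alpha)_{\nu_1\cdots\nu_n}\prod_i(\beta_i)_{\nu_i}}{(\gamma)^\circ_{\nu_1\cdots\nu_n}\prod_i(\varepsilon)^\circ_{\nu_i}}\prod_i\nu_i(z_i).$$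 **Varieties and $L$-functions.** Let $n\ge1$, let $d,a,b_1,\dots,b_n,c$ be positive integers with $d\mid q-1$, and let $\lambda_1,\dots,\lambda_n\in\kappa^\times$. Let $C_{D,\lambda}$ and $S_{D,\lambda}$ be the affine varieties over $\kappa$ given by $$C_{D,\lambda}:\ y^d=\Big(\prod_{i=1}^n(1-\lambda_ix)^{b_i}\Big)x^a(1-x)^c,\qquad S_{D,\lambda}:\ y^d=\Big(1-\sum_{i=1}^n\lambda_ix_i\Big)^a\Big(\prod_{i=1}^nx_i^{b_i}\Big)\Big(1-\sum_{i=1}^nx_i\Big)^c.$$ The group $\mu_d\subset\kappa^\times$ of $d$-th roots of unity acts on both by $y\mapsto\xi y$. For $V$ one of them, $\rho\in\mathrm{Hom}(\mu_d,\overline{\mathbb{Q}}^\times)$, and $\mathrm{Fr}$ the $q$-Frobenius of $V(\overline{\kappa})$, let $$N_r(V;\rho)=\frac1d\sum_{\xi\in\mu_d}\rho(\xi)\,\#\{P\in V(\overline{\kappa})\mid \mathrm{Fr}^r(P)=\xi P\},\qquad L(V,\rho;t)=\exp\Big(\sum_{r=1}^\infty\frac{N_r(V;\rho)}{r}t^r\Big)\in\overline{\mathbb{Q}}[[t]].$$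 Fix a generator $\varphi$ of $\widehat{\kappa^\times}$ and put $\varphi_d=\varphi^{(q-1)/d}$, $\chi=\varphi|_{\mu_d}$ and $\varphi_{d,r}=\varphi_d\circ N_{\kappa_r/\kappa}$. Let $m\in\mathbb{Z}$, let a non-trivial additive character of each $\kappa_r$ be fixed, and put $$f_r(\lambda)=F_D^{(n)}\Big({\varphi_{d,r}^{ma};\overline{\varphi_{d,r}}^{\,mb_1},\dots,\overline{\varphi_{d,r}}^{\,mb_n}\atop\varphi_{d,r}^{m(c+a)}};\lambda_1,\dots,\lambda_n\Big)_{\kappa_r},\qquad g_r(\lambda)=F_D^{(n)}\Big({\overline{\varphi_{d,r}}^{\,ma};\varphi_{d,r}^{mb_1},\dots,\varphi_{d,r}^{mb_n}\atop\varphi_{d,r}^{m(b_1+\cdots+b_n+c)}};\lambda_1,\dots,\lambda_n\Big)_{\kappa_r}.$$ **Theorem.** (i) If $\gcd(d,c)=\gcd(d,b_i)=1$ for all $i$, then $$L(C_{D,\lambda},\chi^m;t)=\begin{cases}\dfrac1{1-qt}&(m\equiv0\bmod d),\\[2mm]\exp\Big(\displaystyle\sum_{r=1}^\infty j(\varphi_d^{ma},\varphi_d^{mc})^r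 f_r(\lambda)\frac{t^r}{r}\Big)^{-1}&(m\not\equiv0\bmod d).\end{cases}$$ (ii) If $\gcd(d,a)=\gcd(d,c)=1$, then $$L(S_{D,\lambda},\chi^m;t)=\begin{cases}\dfrac1{1-q^nt}&(m\equiv0\bmod d),\\[2mm]\exp\Big(\displaystyle\sum_{r=1}^\infty J_D^r\, g_r(\lambda)\frac{t^r}{r}\Big)^{(-1)^n}&(m\not\equiv0\bmod d),\end{cases}$$ where $J_D=j(\varphi_d^{mb_1},\dots,\varphi_d^{mb_n},\varphi_d^{mc})$. -/

import Mathlib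

open scoped BigOperators

noncomputable section

/-- The field of algebraic numbers, in which all characters take their values. -/
abbrev Qbar : Type := AlgebraicClosure ℚ

/-! ### Gauss sums, Jacobi sums and Lauricella's function over a finite field

Multiplicative characters are elements of `MulChar F Qbar`; they vanish at `0`, also the trivial one. -/

section CharacterSums

variable {F : Type*} [Field F] [Fintype F]

/-- The group of multiplicative characters of a finite field is finite. -/
instance mulCharFintype : Fintype (MulChar F Qbar) := Fintype.ofFinite _

/-- `g(η) = - ∑_{x ≠ 0} ψ(x) η(x)`. -/
def gaussG (ψ : AddChar F Qbar) (η : MulChar F Qbar) : Qbar :=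
  - gaussSum η ψ

open Classical in
/-- `g°(η) = q^{δ(η)} g(η)`, where `δ(η)` is `1` for trivial `η` and `0` otherwise. -/
def gaussGCirc (ψ : AddChar F Qbar) (η : MulChar F Qbar) : Qbar :=
  (if η = 1 then (Fintype.card F : Qbar) else 1) * gaussG ψ η

/-- `(α)_ν = g(αν) / g(α)`. -/
def poch (ψ : AddChar F Qbar) (α ν : MulChar F Qbar) : Qbar :=
  gaussG ψ (α * ν) / gaussG ψ α

/-- `(α)°_ν = g°(αν) / g°(α)`. -/
def pochCirc (ψ : AddChar F Qbar) (α ν : MulChar F Qbar) : Qbar :=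
  gaussGCirc ψ (α * ν) / gaussGCirc ψ α

open Classical in
/-- The Jacobi sum of the `n + 1` characters `η 0, …, η n`:
`(-1)^n ∑ ∏ η_i(x_i)` over nonzero `x_0, …, x_n` with `x_0 + ⋯ + x_n = 1`. -/
def jacobiJ {n : ℕ} (η : Fin (n + 1) → MulChar F Qbar) : Qbar :=
  (-1) ^ n * ∑ x : Fin (n + 1) → Fˣ with ∑ i, (x i : F) = 1, ∏ i, η i (x i : F)

/-- Lauricella's function `F_D^{(n)}(α; β_1, …, β_n; γ; z_1, …, z_n)` over `F`. -/
def lauricellaFD (ψ : AddChar F Qbar) {n : ℕ} (α : MulChar F Qbar)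
    (β : Fin n → MulChar F Qbar) (γ : MulChar F Qbar) (z : Fin n → F) : Qbar :=
  1 / (1 - (Fintype.card F : Qbar)) ^ n *
    ∑ ν : Fin n → MulChar F Qbar,
      poch ψ α (∏ i, ν i) * (∏ i, poch ψ (β i) (ν i)) /
        (pochCirc ψ γ (∏ i, ν i) * ∏ i, pochCirc ψ 1 (ν i)) * ∏ i, ν i (z i)

/-- The character `η ∘ N_{L/F}` of a finite extension `L` of `F`. -/
def normLift (L : Type*) [Field L] [Algebra F L] (η : MulChar F Qbar) : MulChar L Qbar :=
  MulChar.ofUnitHom (η.toUnitHom.comp (Units.map (Algebra.norm F : L →* F)))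

end CharacterSums

/-! ### Artin L-functions -/

/-- The power series `exp (∑_{r ≥ 1} u_r t^r / r)`. -/
def expSeries (u : ℕ+ → Qbar) : PowerSeries Qbar :=
  (PowerSeries.exp Qbar).subst
    (PowerSeries.mk fun r : ℕ => if h : 0 < r then u ⟨r, h⟩ / (r : Qbar) else 0)

/-- The power `E^{(-1)^n}` of an invertible power series `E`. -/
def signPow (E : PowerSeries Qbar) (n : ℕ) : PowerSeries Qbar :=
  if Even n then E else E⁻¹

/-- `N_r(V; χ) = (1/#G) ∑_{g ∈ G} χ(g) #{x ∈ V | F^r(x) = g x}`, where `V` is the set of geometric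
points, with its Frobenius `frob` and the action of the finite group `G`. -/
def twistedCount {V : Type*} (frob : V → V) {G : Type*} [CommGroup G] [Finite G] [MulAction G V]
    (χ : G →* Qbarˣ) (r : ℕ+) : Qbar :=
  1 / (Nat.card G : Qbar) *
    ∑ᶠ g : G, (χ g : Qbar) * (Nat.card {x : V // frob^[(r : ℕ)] x = g • x} : Qbar)

/-- The Artin L-function `L(V, χ; t) = exp (∑_{r ≥ 1} N_r(V; χ) t^r / r)`. -/
def artinL {V : Type*} (frob : V → V) {G : Type*} [CommGroup G] [Finite G] [MulAction G V]
    (χ : G →* Qbarˣ) : PowerSeries Qbar :=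
  expSeries (twistedCount frob χ)

/-! ### Affine hypersurfaces `y^d = f(x)` -/

section Cover

variable {k : Type*} [Field k]

/-- The geometric points `(x, y)` of the affine hypersurface `y^d = f(x)`. -/
def CoverPoints (kbar : Type*) [Field kbar] [Algebra k kbar] {σ : Type*} (d : ℕ)
    (f : MvPolynomial σ k) : Type _ :=
  {P : (σ → kbar) × kbar // P.2 ^ d = MvPolynomial.aeval P.1 f}

variable {kbar : Type*} [Field kbar] [Algebra k kbar] {σ : Type*} {d : ℕ} {f : MvPolynomial σ k}

/-- The `q`-Frobenius, raising all coordinates to the power `q = #k`. -/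
def CoverPoints.frob [Fintype k] (P : CoverPoints kbar d f) : CoverPoints kbar d f :=
  ⟨(fun i => P.1.1 i ^ Fintype.card k, P.1.2 ^ Fintype.card k), by
    have h := congrArg (FiniteField.frobeniusAlgHom k kbar) P.2
    rw [map_pow] at h
    exact h.trans (MvPolynomial.comp_aeval_apply P.1.1 (FiniteField.frobeniusAlgHom k kbar) f)⟩

/-- The action `ξ • (x, y) = (x, ξ y)` of the `d`-th roots of unity of `k`. -/
instance CoverPoints.rootsAction : MulAction (rootsOfUnity d k) (CoverPoints kbar d f) where
  smul ξ P := ⟨(P.1.1, algebraMap k kbar ((ξ : kˣ) : k) * P.1.2), by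
    have h : (((ξ : kˣ) : k)) ^ d = 1 := by
      have := (mem_rootsOfUnity d (ξ : kˣ)).1 ξ.2
      simpa using congrArg Units.val this
    simp only [mul_pow, ← map_pow, h, map_one, one_mul]
    exact P.2⟩
  one_smul P := Subtype.ext (Prod.ext rfl (by
    change algebraMap k kbar (((1 : rootsOfUnity d k) : kˣ) : k) * P.1.2 = P.1.2
    simp))
  mul_smul ξ η P := Subtype.ext (Prod.ext rfl (by
    change algebraMap k kbar (((ξ * η : rootsOfUnity d k) : kˣ) : k) * P.1.2
      = algebraMap k kbar ((ξ : kˣ) : k) * (algebraMap k kbar ((η : kˣ) : k) * P.1.2)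
    simp [mul_assoc]))

end Cover

section Varieties

variable {k : Type*} [Field k]

/-- `(∏ (1 - l_i x)^{b_i}) x^a (1 - x)^c`, the right-hand side of the equation of `C_{D,l}`. -/
def polyCD {n : ℕ} (a c : ℕ) (b : Fin n → ℕ) (l : Fin n → k) : MvPolynomial (Fin 1) k :=
  (∏ i, (1 - MvPolynomial.C (l i) * MvPolynomial.X 0) ^ b i) * MvPolynomial.X 0 ^ a *
    (1 - MvPolynomial.X 0) ^ c

/-- `(1 - ∑ l_i x_i)^a (∏ x_i^{b_i}) (1 - ∑ x_i)^c`, the right-hand side of the equation of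
`S_{D,l}`. -/
def polySD {n : ℕ} (a c : ℕ) (b : Fin n → ℕ) (l : Fin n → k) : MvPolynomial (Fin n) k :=
  (1 - ∑ i, MvPolynomial.C (l i) * MvPolynomial.X i) ^ a * (∏ i, MvPolynomial.X i ^ b i) *
    (1 - ∑ i, MvPolynomial.X i) ^ c

variable [Fintype k] (kbar : Type*) [Field kbar] [Algebra k kbar]

/-- `L(C_{D,l}, χ; t)` for a character `χ` of the group of `d`-th roots of unity of `k`. -/
def artinLCD {n : ℕ} (d : ℕ) [NeZero d] (a c : ℕ) (b : Fin n → ℕ) (l : Fin n → k)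
    (χ : rootsOfUnity d k →* Qbarˣ) : PowerSeries Qbar :=
  artinL (CoverPoints.frob : CoverPoints kbar d (polyCD a c b l) → _) χ

/-- `L(S_{D,l}, χ; t)` for a character `χ` of the group of `d`-th roots of unity of `k`. -/
def artinLSD {n : ℕ} (d : ℕ) [NeZero d] (a c : ℕ) (b : Fin n → ℕ) (l : Fin n → k)
    (χ : rootsOfUnity d k →* Qbarˣ) : PowerSeries Qbar :=
  artinL (CoverPoints.frob : CoverPoints kbar d (polySD a c b l) → _) χ

/-- `φ_d = φ^{(q-1)/d}`. -/
def charD (φ : MulChar k Qbar) (d : ℕ) : MulChar k Qbar :=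
  φ ^ ((Fintype.card k - 1) / d)

/-- The restriction of `φ` to the group of `d`-th roots of unity of `k`. -/
def restrictRoots (φ : MulChar k Qbar) (d : ℕ) : rootsOfUnity d k →* Qbarˣ :=
  φ.toUnitHom.comp (rootsOfUnity d k).subtype

end Varieties

end

/-!
Fibre `y^d = f(x)` over `x`. A point on which `Fr^r` acts as a root of unity has `x` rational over
`κ_r`, and by Kummer theory `Fr^r` multiplies `y ≠ 0` by the `d`-th power residue symbol of the norm
of `f(x)`. Orthogonality of characters then gives `N_r(χ^m) = ∑_x φ_{d,r}^m(f(x))`; for trivial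
`χ^m` every fibre contributes `1`.

The finite analogue of the binomial theorem, which is the Fourier expansion of `α⁻¹(1 - ∑ z_i)` with
Jacobi sums as coefficients, identifies this character sum with a Jacobi sum over `κ_r` times `F_D`,
up to sign. By the Hasse–Davenport relation the Jacobi sum over `κ_r` is the `r`-th power of the one
over `κ`. The relation itself comes from the Euler product over monic polynomials of the weight
`χ(∏ x_i) ψ(∑ x_i)`: its generating series is `1 - g t`, because the weights of the polynomials of
each degree `≥ 2` sum to zero, and its logarithmic derivative runs over prime powers.
-/

noncomputable section

section ExpSeries

open PowerSeries

/-- The exponent `∑_{r ≥ 1} u_r t^r / r` of `expSeries u`. -/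
def expSeriesExponent (u : ℕ+ → Qbar) : PowerSeries Qbar :=
  PowerSeries.mk fun r : ℕ => if h : 0 < r then u ⟨r, h⟩ / (r : Qbar) else 0

lemma constantCoeff_expSeriesExponent (u : ℕ+ → Qbar) :
    constantCoeff (expSeriesExponent u) = 0 := by
  simp [expSeriesExponent]

lemma hasSubst_expSeriesExponent (u : ℕ+ → Qbar) : HasSubst (expSeriesExponent u) :=
  HasSubst.of_constantCoeff_zero' (constantCoeff_expSeriesExponent u)

lemma constantCoeff_expSeries (u : ℕ+ → Qbar) : constantCoeff (expSeries u) = 1 := by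
  have hzero : constantCoeff ((exp Qbar - 1).subst (expSeriesExponent u)) = 0 :=
    constantCoeff_subst_eq_zero (constantCoeff_expSeriesExponent u) _ (by simp)
  have hsubst := hasSubst_expSeriesExponent u
  rw [subst_sub hsubst, ← coe_substAlgHom hsubst, map_one, map_sub, map_one, sub_eq_zero,
    coe_substAlgHom] at hzero
  exact hzero

lemma derivative_expSeries (u : ℕ+ → Qbar) :
    d⁄dX Qbar (expSeries u) = expSeries u * mk fun r => u r.succPNat := by
  have hderiv : d⁄dX Qbar (expSeriesExponent u) = mk fun r => u r.succPNat := by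
    ext r
    have : (r : Qbar) + 1 ≠ 0 := by exact_mod_cast r.succ_ne_zero
    simp only [expSeriesExponent, coeff_derivative, coeff_mk, Nat.succ_pos, dif_pos, Nat.cast_succ,
      Nat.succPNat]
    field_simp
  have hchain := derivative_subst (f := exp Qbar) (hasSubst_expSeriesExponent u)
  rwa [derivative_exp, hderiv] at hchain

lemma eq_expSeries {E : PowerSeries Qbar} {u : ℕ+ → Qbar} (hconst : constantCoeff E = 1)
    (hderiv : d⁄dX Qbar E = E * mk fun r => u r.succPNat) : E = expSeries u := by
  have hne : constantCoeff (expSeries u) ≠ 0 := by simp [constantCoeff_expSeries]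
  suffices hquot : E * (expSeries u)⁻¹ = 1 by
    simpa using ((PowerSeries.eq_mul_inv_iff_mul_eq hne).1 hquot.symm).symm
  apply derivative.ext
  · rw [Derivation.leibniz, derivative_inv', derivative_expSeries, hderiv]
    simp only [smul_eq_mul, derivative_one]
    linear_combination (-E * (expSeries u)⁻¹ * mk fun r => u r.succPNat) *
      PowerSeries.mul_inv_cancel _ hne
  · simp [hconst, constantCoeff_expSeries]

lemma expSeries_neg (u : ℕ+ → Qbar) : expSeries (fun r => -u r) = (expSeries u)⁻¹ := by
  have hne : constantCoeff (expSeries u) ≠ 0 := by simp [constantCoeff_expSeries]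
  refine (eq_expSeries (by simp [constantCoeff_expSeries]) ?_).symm
  have hmk : (mk fun r => -u r.succPNat) = -mk fun r => u r.succPNat := by ext; simp
  rw [derivative_inv', derivative_expSeries, hmk]
  linear_combination (-(expSeries u)⁻¹ * mk fun r => u r.succPNat) *
    PowerSeries.mul_inv_cancel _ hne

lemma signPow_expSeries (u : ℕ+ → Qbar) (n : ℕ) :
    signPow (expSeries u) n = expSeries fun r => (-1) ^ n * u r := by
  rcases n.even_or_odd with hn | hn
  · simp [signPow, hn]
  · simp [signPow, hn, Nat.not_even_iff_odd.2 hn, expSeries_neg]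

lemma expSeries_pow (q : Qbar) : expSeries (fun r => q ^ (r : ℕ)) = (1 - C q * X)⁻¹ := by
  refine (eq_expSeries (by simp) ?_).symm
  have hgeom : (mk fun r : ℕ => q ^ (r.succPNat : ℕ)) = C q * (1 - C q * X)⁻¹ := by
    rw [PowerSeries.eq_mul_inv_iff_mul_eq (by simp)]
    ext r
    rw [mul_sub, mul_one, map_sub, mul_left_comm, coeff_C_mul]
    cases r with
    | zero => simp
    | succ r => simp [pow_succ, mul_comm]
  have hlin : d⁄dX Qbar (1 - C q * X) = -C q := by simp [Derivation.leibniz]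
  rw [derivative_inv', hgeom, hlin]
  ring

end ExpSeries

section Characters

lemma mulChar_prod_apply {M R ι : Type*} [CommMonoid M] [CommMonoidWithZero R]
    (η : ι → MulChar M R) (s : Finset ι) {x : M} (hx : IsUnit x) :
    (∏ i ∈ s, η i) x = ∏ i ∈ s, η i x := by
  classical
  induction s using Finset.induction_on with
  | empty => simp [MulChar.one_apply hx]
  | insert i s hi ih => rw [Finset.prod_insert hi, Finset.prod_insert hi, MulChar.mul_apply, ih]

lemma mulChar_apply_neg_one_ne_zero {F R : Type*} [CommRing F] [CommRing R] [Nontrivial R]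
    (η : MulChar F R) : η (-1) ≠ 0 :=
  (isUnit_one.neg.map η).ne_zero

lemma mulChar_inv_apply_neg_one {F R : Type*} [Field F] [CommRing R] (η : MulChar F R) :
    η⁻¹ (-1) = η (-1) := by
  rw [MulChar.inv_apply', inv_neg_one]

lemma addChar_sum_apply {A M ι : Type*} [AddCommMonoid A] [CommMonoid M] (ψ : AddChar A M)
    (s : Finset ι) (x : ι → A) : ψ (∑ i ∈ s, x i) = ∏ i ∈ s, ψ (x i) :=
  map_prod ψ.toMonoidHom (fun i => Multiplicative.ofAdd (x i)) s

lemma sum_mulChar_apply_eq_zero {F R : Type*} [CommRing F] [Finite F] [CommRing R] [IsDomain R]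
    [HasEnoughRootsOfUnity R (Monoid.exponent Fˣ)] [Fintype (MulChar F R)] {x : F} (hx : x ≠ 1) :
    ∑ ν : MulChar F R, ν x = 0 := by
  obtain ⟨χ, hχ⟩ := MulChar.exists_apply_ne_one_of_hasEnoughRootsOfUnity F R hx
  refine eq_zero_of_mul_eq_self_left hχ ?_
  rw [Finset.mul_sum]
  exact Fintype.sum_bijective (χ * ·) (Group.mulLeft_bijective χ) _ _ fun ν => by
    rw [MulChar.mul_apply]

lemma sum_inv_apply_mul_apply {F R : Type*} [Field F] [Fintype F] [DecidableEq F] [CommRing R]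
    [IsDomain R] [HasEnoughRootsOfUnity R (Monoid.exponent Fˣ)] [Fintype (MulChar F R)]
    (x : F) {z : F} (hz : z ≠ 0) :
    ∑ ν : MulChar F R, ν⁻¹ x * ν z = if x = z then (Fintype.card F : R) - 1 else 0 := by
  have hterm (ν : MulChar F R) : ν⁻¹ x * ν z = ν (x⁻¹ * z) := by
    rw [MulChar.inv_apply', map_mul]
  simp only [hterm]
  split_ifs with hxz
  · have hcard : Fintype.card (MulChar F R) = Fintype.card F - 1 := by
      rw [← Nat.card_eq_fintype_card, MulChar.card_eq_card_units_of_hasEnoughRootsOfUnity F R,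
        Nat.card_eq_fintype_card, Fintype.card_units]
    simp [hxz, inv_mul_cancel₀ hz, hcard, Nat.cast_sub Fintype.card_pos]
  · refine sum_mulChar_apply_eq_zero fun h => hxz ?_
    have hx : x ≠ 0 := by rintro rfl; simp at h
    exact ((inv_mul_eq_one₀ hx).1 h)

lemma sum_prod_inv_apply_mul_apply {F R ι : Type*} [Field F] [Fintype F] [DecidableEq F]
    [CommRing R] [IsDomain R] [HasEnoughRootsOfUnity R (Monoid.exponent Fˣ)]
    [Fintype (MulChar F R)] [Fintype ι] [DecidableEq ι] (x : ι → F) {z : ι → F}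
    (hz : ∀ i, z i ≠ 0) :
    ∑ ν : ι → MulChar F R, ∏ i, (ν i)⁻¹ (x i) * ν i (z i) =
      if x = z then ((Fintype.card F : R) - 1) ^ Fintype.card ι else 0 := by
  rw [← Fintype.prod_sum fun i (ν : MulChar F R) => ν⁻¹ (x i) * ν (z i)]
  simp only [sum_inv_apply_mul_apply _ (hz _), Finset.prod_ite_zero, funext_iff, Finset.mem_univ,
    forall_true_left, Finset.prod_const, Finset.card_univ]

end Characters

section JacobiSums

variable {F R ι : Type*} [Field F] [Fintype F] [CommRing R] [Fintype ι] [DecidableEq ι]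

open Classical in
/-- The sum of `∏ η_i(x_i)` over the tuples `x` with `∑ x_i = t`. Its values at `t = 0` and `t = 1`
are the two kinds of Jacobi sum of the family `η`. -/
def levelSum (η : ι → MulChar F R) (t : F) : R :=
  ∑ x : ι → F with ∑ i, x i = t, ∏ i, η i (x i)

lemma levelSum_of_ne_zero (η : ι → MulChar F R) {t : F} (ht : t ≠ 0) :
    levelSum η t = (∏ i, η i) t * levelSum η 1 := by
  classical
  unfold levelSum
  rw [Finset.mul_sum]
  symm
  refine Finset.sum_bij' (fun x _ => t • x) (fun x _ => t⁻¹ • x) ?_ ?_ ?_ ?_ ?_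
  · simp +contextual [← Finset.mul_sum]
  · simp +contextual [← Finset.mul_sum, ht]
  · simp [smul_smul, ht]
  · simp [smul_smul, ht]
  · simp [Finset.prod_mul_distrib, mulChar_prod_apply η _ ht.isUnit]

lemma sum_mul_prod_apply (η : ι → MulChar F R) (w : F → R) :
    ∑ x : ι → F, w (∑ i, x i) * ∏ i, η i (x i) =
      w 0 * levelSum η 0 + levelSum η 1 * ∑ t, (∏ i, η i) t * w t := by
  classical
  have hlevels : ∑ x : ι → F, w (∑ i, x i) * ∏ i, η i (x i) = ∑ t, w t * levelSum η t := by
    rw [← Finset.sum_fiberwise Finset.univ (fun x : ι → F => ∑ i, x i)]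
    refine Finset.sum_congr rfl fun t _ => ?_
    rw [levelSum, Finset.mul_sum]
    exact Finset.sum_congr rfl fun x hx => by rw [(Finset.mem_filter.1 hx).2]
  rw [hlevels, Fintype.sum_eq_add_sum_compl 0, Fintype.sum_eq_add_sum_compl 0
    fun t => (∏ i, η i) t * w t, MulChar.map_zero, zero_mul, zero_add, Finset.mul_sum]
  congr 1
  refine Finset.sum_congr rfl fun t ht => ?_
  rw [levelSum_of_ne_zero η (by simpa using ht)]
  ring

lemma prod_gaussSum (η : ι → MulChar F R) (ψ : AddChar F R) :
    ∏ i, gaussSum (η i) ψ = levelSum η 0 + levelSum η 1 * gaussSum (∏ i, η i) ψ := by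
  classical
  have h := sum_mul_prod_apply η ψ
  rw [AddChar.map_zero_eq_one, one_mul] at h
  unfold gaussSum
  rw [← h, Fintype.prod_sum]
  refine Finset.sum_congr rfl fun x _ => ?_
  rw [Finset.prod_mul_distrib, addChar_sum_apply, mul_comm]

lemma levelSum_zero_add_eq_zero [IsDomain R] {η : ι → MulChar F R} (hη : ∃ i, η i ≠ 1) :
    levelSum η 0 + levelSum η 1 * ∑ t, (∏ i, η i) t = 0 := by
  classical
  obtain ⟨i, hi⟩ := hη
  have h := sum_mul_prod_apply η 1
  simp only [Pi.one_apply, one_mul, mul_one] at h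
  rw [← h, ← Fintype.prod_sum fun i x => η i x]
  exact Finset.prod_eq_zero (Finset.mem_univ i) (MulChar.sum_eq_zero_of_ne_one hi)

lemma levelSum_snoc {n : ℕ} (η : Fin n → MulChar F R) (θ : MulChar F R) (t : F) :
    levelSum (Fin.snoc (α := fun _ => MulChar F R) η θ) t =
      ∑ x : Fin n → F, (∏ i, η i (x i)) * θ (t - ∑ i, x i) := by
  classical
  rw [levelSum, Finset.sum_filter,
    ← (Fin.snocEquiv fun _ : Fin (n + 1) => F).sum_comp,
    Fintype.sum_prod_type, Finset.sum_comm]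
  refine Finset.sum_congr rfl fun x _ => ?_
  simp [Fin.snocEquiv, Fin.prod_univ_castSucc, Fin.sum_univ_castSucc, ← eq_sub_iff_add_eq']

end JacobiSums

section GaussSums

lemma fin_snoc_one {A : Type*} (x y : A) :
    Fin.snoc (α := fun _ => A) (fun _ : Fin 1 => x) y = ![x, y] := by
  funext i
  fin_cases i <;> rfl

variable {F : Type*} [Field F] [Fintype F] {ψ : AddChar F Qbar}

lemma one_sub_card_ne_zero : (1 - Fintype.card F : Qbar) ≠ 0 := by
  rw [sub_ne_zero]
  exact_mod_cast Fintype.one_lt_card.ne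

lemma gaussG_one (hψ : ψ ≠ 1) : gaussG ψ 1 = 1 := by
  rw [gaussG, gaussSum_one_left hψ, neg_neg]

lemma gaussGCirc_one (hψ : ψ ≠ 1) : gaussGCirc ψ 1 = Fintype.card F := by
  rw [gaussGCirc, if_pos rfl, gaussG_one hψ, mul_one]

lemma gaussGCirc_of_ne_one (ψ : AddChar F Qbar) {η : MulChar F Qbar} (hη : η ≠ 1) :
    gaussGCirc ψ η = gaussG ψ η := by
  rw [gaussGCirc, if_neg hη, one_mul]

lemma gaussG_mul_gaussGCirc_inv (hψ : ψ ≠ 1) (η : MulChar F Qbar) :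
    gaussG ψ η * gaussGCirc ψ η⁻¹ = η (-1) * Fintype.card F := by
  by_cases h : η = 1
  · rw [h, inv_one, gaussG_one hψ, gaussGCirc_one hψ, MulChar.one_apply isUnit_one.neg]
  · rw [gaussGCirc_of_ne_one ψ (inv_ne_one.2 h), gaussG, gaussG, neg_mul_neg,
      ← mul_gaussSum_inv_eq_gaussSum η⁻¹, mul_left_comm,
      gaussSum_mul_gaussSum_eq_card h (AddChar.IsPrimitive.of_ne_one hψ),
      mulChar_inv_apply_neg_one]

lemma gaussG_ne_zero (hψ : ψ ≠ 1) (η : MulChar F Qbar) : gaussG ψ η ≠ 0 :=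
  left_ne_zero_of_mul (b := gaussGCirc ψ η⁻¹) <| by
    rw [gaussG_mul_gaussGCirc_inv hψ]
    exact mul_ne_zero (mulChar_apply_neg_one_ne_zero η) (by exact_mod_cast Fintype.card_ne_zero)

lemma gaussGCirc_ne_zero (hψ : ψ ≠ 1) (η : MulChar F Qbar) : gaussGCirc ψ η ≠ 0 :=
  right_ne_zero_of_mul (a := gaussG ψ η⁻¹) <| by
    rw [← inv_inv η, inv_inv η⁻¹, gaussG_mul_gaussGCirc_inv hψ]
    exact mul_ne_zero (mulChar_apply_neg_one_ne_zero _) (by exact_mod_cast Fintype.card_ne_zero)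

lemma jacobiJ_eq_levelSum {n : ℕ} (η : Fin (n + 1) → MulChar F Qbar) :
    jacobiJ η = (-1) ^ n * levelSum η 1 := by
  classical
  unfold jacobiJ levelSum
  congr 1
  refine Finset.sum_of_injOn (fun x i => (x i : F)) ?_ ?_ ?_ ?_
  · exact fun x _ y _ h => funext fun i => Units.ext (congrFun h i)
  · intro x hx
    simpa using hx
  · intro x hx hx'
    by_contra h
    have hne : ∀ i, x i ≠ 0 := fun i hi =>
      h (Finset.prod_eq_zero (Finset.mem_univ i) (by rw [hi, MulChar.map_zero]))
    exact hx' ⟨fun i => Units.mk0 (x i) (hne i), by simpa using hx, rfl⟩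
  · exact fun x _ => rfl

lemma jacobiJ_snoc {n : ℕ} (η : Fin n → MulChar F Qbar) (θ : MulChar F Qbar) :
    jacobiJ (Fin.snoc (α := fun _ => MulChar F Qbar) η θ) =
      (-1) ^ n * ∑ x : Fin n → F, (∏ i, η i (x i)) * θ (1 - ∑ i, x i) := by
  rw [jacobiJ_eq_levelSum, levelSum_snoc]

lemma jacobiJ_mul_gaussGCirc (hψ : ψ ≠ 1) {n : ℕ} {η : Fin (n + 1) → MulChar F Qbar}
    (hη : ∃ i, η i ≠ 1) :
    jacobiJ η * gaussGCirc ψ (∏ i, η i) = ∏ i, gaussG ψ (η i) := by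
  classical
  have hlevels := levelSum_zero_add_eq_zero hη
  have hsign : ∏ i, gaussG ψ (η i) = (-1) ^ (n + 1) * ∏ i, gaussSum (η i) ψ := by
    simp [gaussG, Finset.prod_neg]
  rw [hsign, prod_gaussSum, jacobiJ_eq_levelSum]
  by_cases hprod : ∏ i, η i = 1
  · rw [hprod, MulChar.sum_one_eq_card_units, Fintype.card_units,
      Nat.cast_sub Fintype.card_pos] at hlevels
    rw [hprod, gaussGCirc_one hψ, gaussSum_one_left hψ, eq_neg_of_add_eq_zero_left hlevels]
    push_cast
    ring
  · rw [MulChar.sum_eq_zero_of_ne_one hprod, mul_zero, add_zero] at hlevels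
    rw [gaussGCirc_of_ne_one ψ hprod, hlevels, gaussG]
    ring

lemma jacobiJ_snoc_eq_gaussG (hψ : ψ ≠ 1) {n : ℕ} (η : Fin n → MulChar F Qbar)
    {θ : MulChar F Qbar} (hθ : θ ≠ 1) :
    jacobiJ (Fin.snoc (α := fun _ => MulChar F Qbar) η θ) =
      (∏ i, gaussG ψ (η i)) * gaussG ψ θ / gaussGCirc ψ ((∏ i, η i) * θ) := by
  have h := jacobiJ_mul_gaussGCirc hψ (η := Fin.snoc (α := fun _ => MulChar F Qbar) η θ)
    ⟨Fin.last n, by simpa using hθ⟩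
  simp only [Fin.prod_univ_castSucc, Fin.snoc_castSucc, Fin.snoc_last] at h
  rw [eq_div_iff (gaussGCirc_ne_zero hψ _), h]

lemma jacobiJ_snoc_mul (hψ : ψ ≠ 1) {n : ℕ} (η ν : Fin n → MulChar F Qbar)
    {θ : MulChar F Qbar} (hθ : θ ≠ 1) :
    jacobiJ (Fin.snoc (α := fun _ => MulChar F Qbar) (fun i => η i * ν i) θ) =
      jacobiJ (Fin.snoc (α := fun _ => MulChar F Qbar) η θ) * (∏ i, poch ψ (η i) (ν i)) /
        pochCirc ψ ((∏ i, η i) * θ) (∏ i, ν i) := by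
  rw [jacobiJ_snoc_eq_gaussG hψ _ hθ, jacobiJ_snoc_eq_gaussG hψ _ hθ, Finset.prod_mul_distrib,
    mul_right_comm (∏ i, η i)]
  simp only [poch, pochCirc, Finset.prod_div_distrib]
  have hnum : ∏ i, gaussG ψ (η i) ≠ 0 :=
    Finset.prod_ne_zero_iff.2 fun i _ => gaussG_ne_zero hψ _
  have hden := gaussGCirc_ne_zero hψ ((∏ i, η i) * θ)
  have hden' := gaussGCirc_ne_zero hψ ((∏ i, η i) * θ * ∏ i, ν i)
  field_simp

lemma jacobiJ_pair (α θ : MulChar F Qbar) : jacobiJ ![α, θ] = -∑ x, α x * θ (1 - x) := by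
  have h := jacobiJ_snoc (fun _ : Fin 1 => α) θ
  rw [fin_snoc_one, ← (Equiv.funUnique (Fin 1) F).symm.sum_comp] at h
  simpa using h

lemma jacobiJ_pair_mul (hψ : ψ ≠ 1) (α ν : MulChar F Qbar) {θ : MulChar F Qbar} (hθ : θ ≠ 1) :
    jacobiJ ![α * ν, θ] = jacobiJ ![α, θ] * poch ψ α ν / pochCirc ψ (α * θ) ν := by
  simpa [fin_snoc_one] using jacobiJ_snoc_mul hψ (fun _ : Fin 1 => α) (fun _ => ν) hθ

end GaussSums

section Binomial

variable {F : Type*} [Field F] [Fintype F] {ψ : AddChar F Qbar}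

lemma poch_div_prod_pochCirc (hψ : ψ ≠ 1) {n : ℕ} {α : MulChar F Qbar} (hα : α ≠ 1)
    (ν : Fin n → MulChar F Qbar) :
    poch ψ α (∏ i, ν i) / ∏ i, pochCirc ψ 1 (ν i) =
      jacobiJ (Fin.snoc (α := fun _ => MulChar F Qbar) (fun i => (ν i)⁻¹) α⁻¹) := by
  have hcard : (Fintype.card F : Qbar) ≠ 0 := by exact_mod_cast Fintype.card_ne_zero
  have hG (η : MulChar F Qbar) :
      gaussG ψ η⁻¹ = η (-1) * Fintype.card F / gaussGCirc ψ η := by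
    rw [eq_div_iff (gaussGCirc_ne_zero hψ _), ← mulChar_inv_apply_neg_one,
      ← gaussG_mul_gaussGCirc_inv hψ, inv_inv]
  have hC : gaussGCirc ψ ((∏ i, (ν i)⁻¹) * α⁻¹) =
      (α * ∏ i, ν i) (-1) * Fintype.card F / gaussG ψ (α * ∏ i, ν i) := by
    rw [eq_div_iff (gaussG_ne_zero hψ _), ← gaussG_mul_gaussGCirc_inv hψ, mul_comm]
    simp [mul_comm]
  rw [jacobiJ_snoc_eq_gaussG hψ _ (inv_ne_one.2 hα), hC]
  simp only [hG, poch, pochCirc, one_mul, gaussGCirc_one hψ, gaussGCirc_of_ne_one ψ hα,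
    Finset.prod_div_distrib, Finset.prod_mul_distrib, MulChar.mul_apply,
    mulChar_prod_apply _ _ (isUnit_one.neg : IsUnit (-1 : F)), Finset.prod_const]
  have hcirc : ∏ i, gaussGCirc ψ (ν i) ≠ 0 :=
    Finset.prod_ne_zero_iff.2 fun i _ => gaussGCirc_ne_zero hψ _
  have hval : ∏ i, ν i (-1) ≠ 0 :=
    Finset.prod_ne_zero_iff.2 fun i _ => mulChar_apply_neg_one_ne_zero _
  have hvalα := mulChar_apply_neg_one_ne_zero α
  have hα₀ := gaussG_ne_zero hψ α
  have hαν := gaussG_ne_zero hψ (α * ∏ i, ν i)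
  field_simp

lemma sum_poch_mul_prod_apply (hψ : ψ ≠ 1) {n : ℕ} {α : MulChar F Qbar} (hα : α ≠ 1)
    {z : Fin n → F} (hz : ∀ i, z i ≠ 0) :
    ∑ ν : Fin n → MulChar F Qbar,
        poch ψ α (∏ i, ν i) / (∏ i, pochCirc ψ 1 (ν i)) * ∏ i, ν i (z i) =
      (1 - Fintype.card F) ^ n * α⁻¹ (1 - ∑ i, z i) := by
  classical
  calc _ = (-1) ^ n * ∑ x : Fin n → F, α⁻¹ (1 - ∑ i, x i) *
        ∑ ν : Fin n → MulChar F Qbar, ∏ i, (ν i)⁻¹ (x i) * ν i (z i) := by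
        simp only [poch_div_prod_pochCirc hψ hα, jacobiJ_snoc, Finset.mul_sum, Finset.sum_mul,
          Finset.prod_mul_distrib]
        rw [Finset.sum_comm]
        exact Finset.sum_congr rfl fun x _ => Finset.sum_congr rfl fun ν _ => by ring
    _ = (-1) ^ n * (α⁻¹ (1 - ∑ i, z i) * (Fintype.card F - 1) ^ n) := by
        simp [sum_prod_inv_apply_mul_apply _ hz]
    _ = _ := by
        rw [mul_left_comm, ← mul_pow, neg_one_mul, neg_sub, mul_comm]

lemma sum_poch_mul_apply (hψ : ψ ≠ 1) {β : MulChar F Qbar} (hβ : β ≠ 1) {z : F} (hz : z ≠ 0) :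
    ∑ ν : MulChar F Qbar, poch ψ β ν / pochCirc ψ 1 ν * ν z =
      (1 - Fintype.card F) * β⁻¹ (1 - z) := by
  have h := sum_poch_mul_prod_apply hψ hβ (z := fun _ : Fin 1 => z) fun _ => hz
  rw [← (Equiv.funUnique (Fin 1) (MulChar F Qbar)).symm.sum_comp] at h
  simpa using h

lemma apply_one_sub_sum_mul_prod_apply (hψ : ψ ≠ 1) {n : ℕ} {α : MulChar F Qbar} (hα : α ≠ 1)
    (β : Fin n → MulChar F Qbar) {z : Fin n → F} (hz : ∀ i, z i ≠ 0) (x : Fin n → F) :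
    (1 - (Fintype.card F : Qbar)) ^ n * (α⁻¹ (1 - ∑ i, z i * x i) * ∏ i, β i (x i)) =
      ∑ ν : Fin n → MulChar F Qbar, poch ψ α (∏ i, ν i) / (∏ i, pochCirc ψ 1 (ν i)) *
        (∏ i, ν i (z i)) * ∏ i, (β i * ν i) (x i) := by
  by_cases hx : ∃ i, x i = 0
  · obtain ⟨i, hi⟩ := hx
    have hvanish (η : Fin n → MulChar F Qbar) : ∏ i, η i (x i) = 0 :=
      Finset.prod_eq_zero (Finset.mem_univ i) (by rw [hi, MulChar.map_zero])
    simp only [hvanish, mul_zero, Finset.sum_const_zero]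
  · push Not at hx
    rw [← mul_assoc, ← sum_poch_mul_prod_apply hψ hα fun i => mul_ne_zero (hz i) (hx i),
      Finset.sum_mul]
    refine Finset.sum_congr rfl fun ν _ => ?_
    simp only [map_mul, MulChar.mul_apply, Finset.prod_mul_distrib]
    ring

lemma prod_apply_one_sub_mul_apply (hψ : ψ ≠ 1) {n : ℕ} (α : MulChar F Qbar)
    {β : Fin n → MulChar F Qbar} (hβ : ∀ i, β i ≠ 1) {z : Fin n → F} (hz : ∀ i, z i ≠ 0) (x : F) :
    (1 - (Fintype.card F : Qbar)) ^ n * ((∏ i, (β i)⁻¹ (1 - z i * x)) * α x) =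
      ∑ ν : Fin n → MulChar F Qbar, (∏ i, poch ψ (β i) (ν i)) / (∏ i, pochCirc ψ 1 (ν i)) *
        (∏ i, ν i (z i)) * (α * ∏ i, ν i) x := by
  by_cases hx : x = 0
  · simp only [hx, MulChar.map_zero, mul_zero, Finset.sum_const_zero]
  · have hprod : (1 - (Fintype.card F : Qbar)) ^ n * ∏ i, (β i)⁻¹ (1 - z i * x) =
        ∏ i, ∑ ν : MulChar F Qbar, poch ψ (β i) ν / pochCirc ψ 1 ν * ν (z i * x) := by
      simp only [sum_poch_mul_apply hψ (hβ _) (mul_ne_zero (hz _) hx), Finset.prod_mul_distrib,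
        Finset.prod_const, Finset.card_univ, Fintype.card_fin]
    rw [← mul_assoc, hprod, Fintype.prod_sum, Finset.sum_mul]
    refine Finset.sum_congr rfl fun ν _ => ?_
    simp only [map_mul, MulChar.mul_apply, Finset.prod_mul_distrib, Finset.prod_div_distrib,
      mulChar_prod_apply _ _ (isUnit_iff_ne_zero.2 hx)]
    ring

theorem jacobiJ_snoc_mul_lauricellaFD (hψ : ψ ≠ 1) {n : ℕ} {α θ : MulChar F Qbar} (hα : α ≠ 1)
    (hθ : θ ≠ 1) (β : Fin n → MulChar F Qbar) {z : Fin n → F} (hz : ∀ i, z i ≠ 0) :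
    jacobiJ (Fin.snoc (α := fun _ => MulChar F Qbar) β θ) *
        lauricellaFD ψ α β ((∏ i, β i) * θ) z =
      (-1) ^ n * ∑ x : Fin n → F,
        α⁻¹ (1 - ∑ i, z i * x i) * (∏ i, β i (x i)) * θ (1 - ∑ i, x i) := by
  have hcard : (1 - (Fintype.card F : Qbar)) ^ n ≠ 0 := pow_ne_zero _ one_sub_card_ne_zero
  rw [lauricellaFD, mul_left_comm, one_div, inv_mul_eq_iff_eq_mul₀ hcard]
  calc _ = ∑ ν : Fin n → MulChar F Qbar, poch ψ α (∏ i, ν i) / (∏ i, pochCirc ψ 1 (ν i)) *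
        (∏ i, ν i (z i)) *
          jacobiJ (Fin.snoc (α := fun _ => MulChar F Qbar) (fun i => β i * ν i) θ) := by
        rw [Finset.mul_sum]
        refine Finset.sum_congr rfl fun ν _ => ?_
        rw [jacobiJ_snoc_mul hψ β ν hθ]
        ring
    _ = (-1) ^ n * ∑ x : Fin n → F, (∑ ν : Fin n → MulChar F Qbar,
          poch ψ α (∏ i, ν i) / (∏ i, pochCirc ψ 1 (ν i)) * (∏ i, ν i (z i)) *
            ∏ i, (β i * ν i) (x i)) * θ (1 - ∑ i, x i) := by
        simp only [jacobiJ_snoc, Finset.mul_sum, Finset.sum_mul]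
        rw [Finset.sum_comm]
        exact Finset.sum_congr rfl fun x _ => Finset.sum_congr rfl fun ν _ => by ring
    _ = _ := by
        simp only [← apply_one_sub_sum_mul_prod_apply hψ hα β hz]
        simp only [mul_assoc, ← Finset.mul_sum]
        ring

theorem jacobiJ_pair_mul_lauricellaFD (hψ : ψ ≠ 1) {n : ℕ} (α : MulChar F Qbar)
    {θ : MulChar F Qbar} (hθ : θ ≠ 1) {β : Fin n → MulChar F Qbar} (hβ : ∀ i, β i ≠ 1)
    {z : Fin n → F} (hz : ∀ i, z i ≠ 0) :
    jacobiJ ![α, θ] * lauricellaFD ψ α β (α * θ) z =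
      -∑ x, (∏ i, (β i)⁻¹ (1 - z i * x)) * α x * θ (1 - x) := by
  have hcard : (1 - (Fintype.card F : Qbar)) ^ n ≠ 0 := pow_ne_zero _ one_sub_card_ne_zero
  rw [lauricellaFD, mul_left_comm, one_div, inv_mul_eq_iff_eq_mul₀ hcard]
  calc _ = ∑ ν : Fin n → MulChar F Qbar, (∏ i, poch ψ (β i) (ν i)) / (∏ i, pochCirc ψ 1 (ν i)) *
        (∏ i, ν i (z i)) * jacobiJ ![α * ∏ i, ν i, θ] := by
        rw [Finset.mul_sum]
        refine Finset.sum_congr rfl fun ν _ => ?_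
        rw [jacobiJ_pair_mul hψ α _ hθ]
        ring
    _ = -∑ x, (∑ ν : Fin n → MulChar F Qbar,
          (∏ i, poch ψ (β i) (ν i)) / (∏ i, pochCirc ψ 1 (ν i)) * (∏ i, ν i (z i)) *
            (α * ∏ i, ν i) x) * θ (1 - x) := by
        simp only [jacobiJ_pair, mul_neg, Finset.sum_neg_distrib, Finset.mul_sum, Finset.sum_mul]
        rw [Finset.sum_comm]
        exact congrArg _ (Finset.sum_congr rfl fun x _ => Finset.sum_congr rfl fun ν _ => by ring)
    _ = _ := by
        simp only [← prod_apply_one_sub_mul_apply hψ α hβ hz]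
        simp only [mul_assoc, ← Finset.mul_sum]
        ring

end Binomial

section PrimePowers

open Polynomial UniqueFactorizationMonoid
open scoped Classical

variable {k : Type*} [Field k]

lemma radical_pow_of_monic_irreducible {P : k[X]} (hP : P.Monic) (hi : Irreducible P) {e : ℕ}
    (he : e ≠ 0) : radical (P ^ e) = P := by
  rw [radical_pow_of_prime hi.prime he, hP.normalize_eq_self]

lemma exists_monic_irreducible_pow_eq {g : k[X]} (hg : g.Monic) (h : IsPrimePow g) :
    ∃ (P : k[X]) (e : ℕ), P.Monic ∧ Irreducible P ∧ e ≠ 0 ∧ P ^ e = g := by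
  obtain ⟨p, e, hp, he, rfl⟩ := h
  refine ⟨normalize p, e, monic_normalize hp.ne_zero,
    (normalize_associated p).symm.irreducible hp.irreducible, he.ne', ?_⟩
  rw [← coe_normalizeHom, ← map_pow, coe_normalizeHom, hg.normalize_eq_self]

/-- The von Mangoldt function of `k[X]`: the degree of the irreducible factor of a prime power, and
`0` on all other polynomials. -/
def polyMangoldt (f : k[X]) : ℕ := if IsPrimePow f then (radical f).natDegree else 0

variable (k) in
lemma polyMangoldt_one : polyMangoldt (1 : k[X]) = 0 := if_neg not_isPrimePow_one

lemma polyMangoldt_pow {P : k[X]} (hP : P.Monic) (hi : Irreducible P) {e : ℕ} (he : e ≠ 0) :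
    polyMangoldt (P ^ e) = P.natDegree := by
  rw [polyMangoldt, if_pos (hi.prime.isPrimePow.pow he), radical_pow_of_monic_irreducible hP hi he]

lemma pow_dvd_iff_le_count_normalizedFactors {f P : k[X]} (hf : f ≠ 0) (hP : P.Monic)
    (hi : Irreducible P) {e : ℕ} : P ^ e ∣ f ↔ e ≤ (normalizedFactors f).count P := by
  rw [pow_dvd_iff_le_emultiplicity, emultiplicity_eq_count_normalizedFactors hi hf,
    hP.normalize_eq_self, Nat.cast_le]

lemma mem_primeFactors_iff_monic {f P : k[X]} (hf : f ≠ 0) :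
    P ∈ primeFactors f ↔ Irreducible P ∧ P.Monic ∧ P ∣ f := by
  rw [mem_primeFactors, Polynomial.mem_normalizedFactors_iff hf]

lemma sum_count_mul_natDegree {f : k[X]} (hf : f.Monic) :
    ∑ P ∈ primeFactors f, (normalizedFactors f).count P * P.natDegree = f.natDegree := by
  have hprod : (normalizedFactors f).prod = f := by
    simpa [hf.leadingCoeff] using leadingCoeff_mul_prod_normalizedFactors f
  conv_rhs => rw [← hprod, natDegree_multiset_prod_of_monic _ fun P hP =>
    ((Polynomial.mem_normalizedFactors_iff hf.ne_zero).1 hP).2.1, Finset.sum_multiset_map_count,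
    toFinset_normalizedFactors]
  simp only [smul_eq_mul]

end PrimePowers

section MonicPolynomials

open Polynomial UniqueFactorizationMonoid
open scoped Classical

variable {k : Type*} [Field k] [Finite k]

variable (k) in
lemma finite_monic_natDegree_eq (n : ℕ) : {f : k[X] | f.Monic ∧ f.natDegree = n}.Finite := by
  have : Finite (degreeLT k (n + 1)) := .of_equiv _ (degreeLTEquiv k (n + 1)).toEquiv.symm
  refine (Set.toFinite (degreeLT k (n + 1) : Set k[X])).subset fun f hf => ?_
  exact mem_degreeLT.2 (degree_le_natDegree.trans_lt (by rw [hf.2]; exact_mod_cast n.lt_succ_self))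

variable (k) in
/-- The monic polynomials of degree `n` over a finite field. -/
def monics (n : ℕ) : Finset k[X] := (finite_monic_natDegree_eq k n).toFinset

@[simp]
lemma mem_monics {n : ℕ} {f : k[X]} : f ∈ monics k n ↔ f.Monic ∧ f.natDegree = n := by
  simp [monics]

variable (k) in
lemma monics_zero : monics k 0 = {1} := by
  ext f
  rw [mem_monics, Finset.mem_singleton]
  exact ⟨fun h => (Monic.natDegree_eq_zero h.1).1 h.2, fun h => h ▸ by simp⟩

/-- The monic divisors of a nonzero polynomial over a finite field. -/
def monicDivisors (f : k[X]) : Finset k[X] :=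
  ((Finset.range (f.natDegree + 1)).biUnion (monics k)).filter (· ∣ f)

lemma mem_monicDivisors {f g : k[X]} (hf : f ≠ 0) : g ∈ monicDivisors f ↔ g.Monic ∧ g ∣ f := by
  simp only [monicDivisors, Finset.mem_filter, Finset.mem_biUnion, Finset.mem_range, mem_monics]
  refine ⟨?_, fun h => ⟨⟨_, Nat.lt_succ_of_le (natDegree_le_of_dvd h.2 hf), h.1, rfl⟩, h.2⟩⟩
  rintro ⟨⟨_, -, hg, -⟩, hdvd⟩
  exact ⟨hg, hdvd⟩

lemma sum_monicDivisors_filter_isPrimePow {A : Type*} [AddCommMonoid A] {f : k[X]} (hf : f ≠ 0)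
    (F : k[X] → A) :
    ∑ g ∈ monicDivisors f with IsPrimePow g, F g =
      ∑ P ∈ primeFactors f, ∑ e ∈ Finset.Icc 1 ((normalizedFactors f).count P), F (P ^ e) := by
  rw [Finset.sum_sigma']
  symm
  refine Finset.sum_bij (fun x _ => x.1 ^ x.2) ?_ ?_ ?_ fun _ _ => rfl
  · rintro ⟨P, e⟩ hx
    simp only [Finset.mem_sigma, mem_primeFactors_iff_monic hf, Finset.mem_Icc] at hx
    obtain ⟨⟨hi, hP, -⟩, he, he'⟩ := hx
    rw [← pow_dvd_iff_le_count_normalizedFactors hf hP hi] at he'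
    exact Finset.mem_filter.2 ⟨(mem_monicDivisors hf).2 ⟨hP.pow e, he'⟩,
      hi.prime.isPrimePow.pow (Nat.one_le_iff_ne_zero.1 he)⟩
  · rintro ⟨P, e⟩ hx ⟨Q, e'⟩ hy (h : P ^ e = Q ^ e')
    simp only [Finset.mem_sigma, mem_primeFactors_iff_monic hf, Finset.mem_Icc] at hx hy
    obtain ⟨⟨hPi, hP, -⟩, he, -⟩ := hx
    obtain ⟨⟨hQi, hQ, -⟩, he', -⟩ := hy
    obtain rfl : P = Q := by
      rw [← radical_pow_of_monic_irreducible hP hPi (Nat.one_le_iff_ne_zero.1 he), h,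
        radical_pow_of_monic_irreducible hQ hQi (Nat.one_le_iff_ne_zero.1 he')]
    rw [pow_injective_of_not_isUnit hPi.not_isUnit hPi.ne_zero h]
  · intro g hg
    simp only [Finset.mem_filter, mem_monicDivisors hf] at hg
    obtain ⟨P, e, hP, hi, he, rfl⟩ := exists_monic_irreducible_pow_eq hg.1.1 hg.2
    refine ⟨⟨P, e⟩, ?_, rfl⟩
    simp only [Finset.mem_sigma, mem_primeFactors_iff_monic hf, Finset.mem_Icc,
      ← pow_dvd_iff_le_count_normalizedFactors hf hP hi]
    exact ⟨⟨hi, hP, (dvd_pow_self P he).trans hg.1.2⟩, Nat.one_le_iff_ne_zero.2 he, hg.1.2⟩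

lemma sum_monicDivisors_polyMangoldt {f : k[X]} (hf : f.Monic) :
    ∑ g ∈ monicDivisors f, polyMangoldt g = f.natDegree := by
  have hfilter : ∑ g ∈ monicDivisors f with IsPrimePow g, polyMangoldt g =
      ∑ g ∈ monicDivisors f, polyMangoldt g :=
    Finset.sum_filter_of_ne fun g _ h => by_contra fun hg => h (if_neg hg)
  rw [← hfilter, sum_monicDivisors_filter_isPrimePow hf.ne_zero, ← sum_count_mul_natDegree hf]
  refine Finset.sum_congr rfl fun P hP => ?_
  obtain ⟨hi, hPm, -⟩ := (mem_primeFactors_iff_monic hf.ne_zero).1 hP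
  rw [Finset.sum_congr rfl fun e he => polyMangoldt_pow hPm hi
    (Nat.one_le_iff_ne_zero.1 (Finset.mem_Icc.1 he).1), Finset.sum_const, Nat.card_Icc,
    Nat.add_sub_cancel, smul_eq_mul]

lemma sum_monics_sum_monicDivisors {A : Type*} [AddCommMonoid A] (n : ℕ) (F : k[X] → k[X] → A) :
    ∑ f ∈ monics k n, ∑ g ∈ monicDivisors f, F f g =
      ∑ p ∈ Finset.HasAntidiagonal.antidiagonal n,
        ∑ g ∈ monics k p.1, ∑ h ∈ monics k p.2, F (g * h) g := by
  simp only [← Finset.sum_product']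
  rw [Finset.sum_sigma', Finset.sum_sigma']
  symm
  refine Finset.sum_bij (fun x _ => ⟨x.2.1 * x.2.2, x.2.1⟩) ?_ ?_ ?_ fun _ _ => rfl
  · rintro ⟨p, g, h⟩ hx
    simp only [Finset.mem_sigma, Finset.HasAntidiagonal.mem_antidiagonal, Finset.mem_product,
      mem_monics] at hx
    obtain ⟨hp, ⟨hg, hgd⟩, hh, hhd⟩ := hx
    rw [Finset.mem_sigma, mem_monics, mem_monicDivisors (hg.mul hh).ne_zero,
      hg.natDegree_mul hh, hgd, hhd]
    exact ⟨⟨hg.mul hh, hp⟩, hg, dvd_mul_right g h⟩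
  · rintro ⟨p, g, h⟩ hx ⟨p', g', h'⟩ hy heq
    simp only [Finset.mem_sigma, Finset.mem_product, mem_monics] at hx hy
    simp only [Sigma.mk.injEq, heq_eq_eq] at heq
    obtain ⟨hmul, rfl⟩ := heq
    obtain rfl := mul_left_cancel₀ hx.2.1.1.ne_zero hmul
    obtain rfl : p = p' := Prod.ext (hx.2.1.2.symm.trans hy.2.1.2) (hx.2.2.2.symm.trans hy.2.2.2)
    rfl
  · rintro ⟨f, g⟩ hx
    obtain ⟨⟨hf, rfl⟩, hgf⟩ : (f.Monic ∧ f.natDegree = n) ∧ g ∈ monicDivisors f := by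
      simpa using hx
    obtain ⟨hg, h, rfl⟩ := (mem_monicDivisors hf.ne_zero).1 hgf
    have hh : h.Monic := hg.of_mul_monic_left hf
    refine ⟨⟨(g.natDegree, h.natDegree), g, h⟩, ?_, rfl⟩
    simp [hg, hh, hg.natDegree_mul hh]

end MonicPolynomials

section HasseDavenport

open Polynomial
open Finset.HasAntidiagonal (antidiagonal)

variable {k : Type*} [Field k] {R : Type*} [CommRing R]

lemma natCast_mul_sum_monics [Finite k] {w : k[X] → R}
    (hw : ∀ f g : k[X], f.Monic → g.Monic → w (f * g) = w f * w g) (n : ℕ) :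
    n * ∑ f ∈ monics k n, w f =
      ∑ p ∈ antidiagonal n,
        (∑ g ∈ monics k p.1, polyMangoldt g * w g) * ∑ h ∈ monics k p.2, w h := by
  calc n * ∑ f ∈ monics k n, w f
    _ = ∑ f ∈ monics k n, ∑ g ∈ monicDivisors f, polyMangoldt g * w f := by
      rw [Finset.mul_sum]
      refine Finset.sum_congr rfl fun f hf => ?_
      obtain ⟨hfm, hfd⟩ := mem_monics.1 hf
      rw [← Finset.sum_mul, ← Nat.cast_sum, sum_monicDivisors_polyMangoldt hfm, hfd]
    _ = ∑ p ∈ antidiagonal n, ∑ g ∈ monics k p.1, ∑ h ∈ monics k p.2,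
          polyMangoldt g * w g * w h := by
      rw [sum_monics_sum_monicDivisors]
      refine Finset.sum_congr rfl fun p _ => Finset.sum_congr rfl fun g hg =>
        Finset.sum_congr rfl fun h hh => ?_
      rw [hw g h (mem_monics.1 hg).1 (mem_monics.1 hh).1, mul_assoc]
    _ = _ := by simp only [Finset.sum_mul_sum]

variable (χ : MulChar k R) (ψ : AddChar k R)

/-- The multiplicative weight on monic polynomials whose value at `∏ (X - x_i)` is
`χ (∏ x_i) ψ (∑ x_i)`. -/
def polyWeight (f : k[X]) : R := χ ((-1) ^ f.natDegree * f.coeff 0) * ψ (-f.nextCoeff)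

lemma polyWeight_one : polyWeight χ ψ 1 = 1 := by
  have : (1 : k[X]).nextCoeff = 0 := by
    rw [← C_1, nextCoeff_C_eq_zero]
  simp [polyWeight, this]

lemma polyWeight_X_sub_C (x : k) : polyWeight χ ψ (X - C x) = χ x * ψ x := by
  simp [polyWeight, nextCoeff_X_sub_C]

variable {χ ψ} in
lemma polyWeight_mul {f g : k[X]} (hf : f.Monic) (hg : g.Monic) :
    polyWeight χ ψ (f * g) = polyWeight χ ψ f * polyWeight χ ψ g := by
  simp only [polyWeight, hf.nextCoeff_mul hg, hf.natDegree_mul hg, mul_coeff_zero, neg_add,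
    AddChar.map_add_eq_mul, pow_add, map_mul]
  ring

lemma polyWeight_pow {f : k[X]} (hf : f.Monic) (e : ℕ) :
    polyWeight χ ψ (f ^ e) = polyWeight χ ψ f ^ e := by
  induction e with
  | zero => simp [polyWeight_one]
  | succ e ih => rw [pow_succ, polyWeight_mul (hf.pow e) hf, ih, pow_succ]

lemma sum_monics_zero_polyWeight [Finite k] : ∑ f ∈ monics k 0, polyWeight χ ψ f = 1 := by
  rw [monics_zero, Finset.sum_singleton, polyWeight_one]

lemma sum_monics_one_polyWeight [Fintype k] :
    ∑ f ∈ monics k 1, polyWeight χ ψ f = gaussSum χ ψ := by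
  symm
  refine Finset.sum_bij (fun x _ => X - C x) (fun x _ => by simp [monic_X_sub_C])
    (fun x _ y _ h => by simpa using h) (fun f hf => ?_) fun x _ => (polyWeight_X_sub_C χ ψ x).symm
  rw [mem_monics] at hf
  refine ⟨-f.coeff 0, Finset.mem_univ _, ?_⟩
  rw [C_neg, sub_neg_eq_add]
  exact (hf.1.eq_X_add_C hf.2).symm

variable {ψ} [IsDomain R]

lemma sum_monics_polyWeight_eq_zero [Finite k] (hψ : ψ ≠ 1) {n : ℕ} (hn : 2 ≤ n) :
    ∑ f ∈ monics k n, polyWeight χ ψ f = 0 := by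
  -- Shifting the next-to-leading coefficient by `-t` multiplies the sum by `ψ t`.
  obtain ⟨t, ht⟩ := AddChar.ne_one_iff.1 hψ
  have hshift (s : k) (f : k[X]) (hf : f ∈ monics k n) : f + C s * X ^ (n - 1) ∈ monics k n := by
    rw [mem_monics] at hf ⊢
    have hlt : (C s * X ^ (n - 1)).degree < f.degree := by
      rw [degree_eq_natDegree hf.1.ne_zero, hf.2]
      exact (degree_C_mul_X_pow_le _ _).trans_lt (by exact_mod_cast (by omega : n - 1 < n))
    exact ⟨hf.1.add_of_left hlt, by rw [natDegree_add_eq_left_of_degree_lt hlt, hf.2]⟩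
  have hweight (f : k[X]) (hf : f ∈ monics k n) :
      ψ t * polyWeight χ ψ f = polyWeight χ ψ (f + C (-t) * X ^ (n - 1)) := by
    have hd := (mem_monics.1 hf).2
    have hd' := (mem_monics.1 (hshift (-t) f hf)).2
    rw [polyWeight, polyWeight, nextCoeff_of_natDegree_pos (by omega),
      nextCoeff_of_natDegree_pos (by omega), hd, hd', coeff_add, coeff_add, coeff_C_mul,
      coeff_C_mul, coeff_X_pow, coeff_X_pow, if_pos rfl, if_neg (by omega), mul_one, mul_zero,
      add_zero, neg_add, neg_neg, AddChar.map_add_eq_mul]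
    ring
  refine eq_zero_of_mul_eq_self_left ht ?_
  rw [Finset.mul_sum]
  exact Finset.sum_bij' (fun f _ => f + C (-t) * X ^ (n - 1)) (fun f _ => f + C t * X ^ (n - 1))
    (hshift _) (hshift _) (fun f _ => by rw [C_neg]; ring) (fun f _ => by rw [C_neg]; ring) hweight

lemma sum_monics_polyMangoldt_mul_polyWeight [Fintype k] (hψ : ψ ≠ 1) (n : ℕ) :
    ∑ g ∈ monics k (n + 1), polyMangoldt g * polyWeight χ ψ g = -(-gaussSum χ ψ) ^ (n + 1) := by
  have hrec := natCast_mul_sum_monics fun f g hf hg => polyWeight_mul (χ := χ) (ψ := ψ) hf hg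
  simp only [Finset.Nat.sum_antidiagonal_eq_sum_range_succ_mk] at hrec
  induction n with
  | zero =>
    simpa [Finset.sum_range_succ, monics_zero, polyMangoldt_one, polyWeight_one,
      sum_monics_one_polyWeight] using (hrec 1).symm
  | succ n ih =>
    have h := hrec (n + 2)
    have hvanish : ∀ j ∈ Finset.range (n + 1),
        (∑ g ∈ monics k j, (polyMangoldt g : R) * polyWeight χ ψ g) *
          ∑ f ∈ monics k (n + 2 - j), polyWeight χ ψ f = 0 := fun j hj => by
      rw [Finset.mem_range] at hj
      rw [sum_monics_polyWeight_eq_zero χ hψ (by omega), mul_zero]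
    rw [sum_monics_polyWeight_eq_zero χ hψ (by omega), mul_zero, Finset.sum_range_succ,
      Finset.sum_range_succ, Finset.sum_eq_zero hvanish, zero_add, Nat.sub_self,
      sum_monics_zero_polyWeight, mul_one, show n + 2 - (n + 1) = 1 by omega,
      sum_monics_one_polyWeight, ih] at h
    rw [eq_neg_of_add_eq_zero_right h.symm]
    ring

end HasseDavenport

section HasseDavenportExtension

open Polynomial IntermediateField UniqueFactorizationMonoid
open scoped Classical

variable {k : Type*} [Field k] {L : Type*} [Field L] [Algebra k L]

lemma minpoly_pow_mem_monics [Finite k] [FiniteDimensional k L] (x : L) :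
    minpoly k x ^ (Module.finrank k L / (minpoly k x).natDegree) ∈
      monics k (Module.finrank k L) := by
  have hx : IsIntegral k x := .of_finite k x
  rw [mem_monics, (minpoly.monic hx).natDegree_pow, Nat.div_mul_cancel (minpoly.degree_dvd hx)]
  exact ⟨(minpoly.monic hx).pow _, rfl⟩

lemma norm_mul_trace_eq_polyWeight [FiniteDimensional k L] {R : Type*} [CommRing R]
    (χ : MulChar k R) (ψ : AddChar k R) (x : L) :
    χ (Algebra.norm k x) * ψ (Algebra.trace k L x) =
      polyWeight χ ψ (minpoly k x ^ (Module.finrank k L / (minpoly k x).natDegree)) := by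
  have hx : IsIntegral k x := .of_finite k x
  have hfin : Module.finrank k L / (minpoly k x).natDegree = Module.finrank k⟮x⟯ L := by
    rw [← Module.finrank_mul_finrank k k⟮x⟯ L, adjoin.finrank hx,
      Nat.mul_div_cancel_left _ (minpoly.natDegree_pos hx)]
  have hN := Algebra.PowerBasis.norm_gen_eq_coeff_zero_minpoly (adjoin.powerBasis hx)
  rw [adjoin.powerBasis_gen, adjoin.powerBasis_dim, minpoly_gen] at hN
  rw [polyWeight_pow χ ψ (minpoly.monic hx), hfin, Algebra.norm_eq_norm_adjoin,
    trace_eq_finrank_mul_minpoly_nextCoeff, hN, polyWeight, map_pow, mul_pow, ← nsmul_eq_mul,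
    AddChar.map_nsmul_eq_pow]

variable [Fintype L]

lemma card_filter_minpoly_eq [Finite k] {P : k[X]} (hP : P.Monic) (hi : Irreducible P)
    (hd : P.natDegree ∣ Module.finrank k L) :
    (Finset.univ.filter fun x : L => minpoly k x = P).card = P.natDegree := by
  have : Fact (Irreducible P) := ⟨hi⟩
  have hfin : Module.finrank k (AdjoinRoot P) = P.natDegree := by
    rw [(AdjoinRoot.powerBasis hP.ne_zero).finrank, AdjoinRoot.powerBasis_dim]
  have h := FiniteField.natCard_algHom_of_finrank_dvd (F := k) (K := AdjoinRoot P) (L := L)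
    (by rwa [hfin])
  rw [hfin, Nat.card_congr (AdjoinRoot.equiv L k P hP.ne_zero)] at h
  rw [← h, ← Fintype.card_subtype, Nat.card_eq_fintype_card]
  refine Fintype.card_congr (Equiv.subtypeEquivRight fun x => ?_)
  rw [mem_aroots]
  constructor
  · rintro rfl
    exact ⟨hP.ne_zero, minpoly.aeval k x⟩
  · rintro ⟨-, h0⟩
    exact (minpoly.eq_of_irreducible_of_monic hi h0 hP).symm

lemma card_filter_minpoly_pow_eq [Finite k] {g : k[X]} (hg : g ∈ monics k (Module.finrank k L)) :
    (Finset.univ.filter fun x : L =>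
      minpoly k x ^ (Module.finrank k L / (minpoly k x).natDegree) = g).card = polyMangoldt g := by
  obtain ⟨hgm, hgd⟩ := mem_monics.1 hg
  have hint (x : L) : IsIntegral k x := .of_finite k x
  have hexp (x : L) : Module.finrank k L / (minpoly k x).natDegree ≠ 0 :=
    (Nat.div_pos (minpoly.natDegree_le x) (minpoly.natDegree_pos (hint x))).ne'
  by_cases h : IsPrimePow g
  · obtain ⟨P, e, hP, hi, he, rfl⟩ := exists_monic_irreducible_pow_eq hgm h
    rw [hP.natDegree_pow] at hgd
    rw [polyMangoldt_pow hP hi he, ← card_filter_minpoly_eq hP hi (hgd ▸ dvd_mul_left _ _)]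
    congr 1
    ext x
    simp only [Finset.mem_filter, Finset.mem_univ, true_and]
    constructor
    · intro hx
      rw [← radical_pow_of_monic_irreducible hP hi he, ← hx, radical_pow_of_monic_irreducible
        (minpoly.monic (hint x)) (minpoly.irreducible (hint x)) (hexp x)]
    · rintro rfl
      rw [← hgd, Nat.mul_div_cancel _ (minpoly.natDegree_pos (hint x))]
  · rw [polyMangoldt, if_neg h, Finset.card_eq_zero, Finset.filter_eq_empty_iff]
    rintro x - rfl
    exact h ((minpoly.irreducible (hint x)).prime.isPrimePow.pow (hexp x))

/-- The **Hasse–Davenport relation**. -/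
theorem neg_sum_norm_mul_trace [Fintype k] {R : Type*} [CommRing R] [IsDomain R] (χ : MulChar k R)
    {ψ : AddChar k R} (hψ : ψ ≠ 1) :
    -∑ x : L, χ (Algebra.norm k x) * ψ (Algebra.trace k L x) =
      (-gaussSum χ ψ) ^ Module.finrank k L := by
  obtain ⟨n, hn⟩ := Nat.exists_eq_add_of_le' (Module.finrank_pos (R := k) (M := L))
  rw [hn, ← neg_eq_iff_eq_neg.2 (sum_monics_polyMangoldt_mul_polyWeight χ hψ n), ← hn, neg_inj,
    ← Finset.sum_fiberwise_of_maps_to fun x _ => minpoly_pow_mem_monics (k := k) x]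
  refine Finset.sum_congr rfl fun g hg => ?_
  rw [← card_filter_minpoly_pow_eq hg, ← nsmul_eq_mul, ← Finset.sum_const]
  refine Finset.sum_congr rfl fun x hx => ?_
  rw [norm_mul_trace_eq_polyWeight, (Finset.mem_filter.1 hx).2]

end HasseDavenportExtension

lemma exists_addChar_ne_one (k : Type*) [Field k] [Finite k] : ∃ ψ : AddChar k Qbar, ψ ≠ 1 := by
  obtain ⟨f, hf⟩ := CommGroup.exists_apply_ne_one_of_hasEnoughRootsOfUnity (Multiplicative k) Qbar
    (a := Multiplicative.ofAdd 1) (by simp)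
  exact ⟨AddChar.toMonoidHomEquiv.symm ((Units.coeHom Qbar).comp f),
    AddChar.ne_one_iff.2 ⟨1, fun h => hf (Units.ext h)⟩⟩

section NormLift

variable {k : Type*} [Field k] {L : Type*} [Field L] [Algebra k L] [FiniteDimensional k L]

lemma normLift_apply (η : MulChar k Qbar) (x : L) : normLift L η x = η (Algebra.norm k x) := by
  by_cases hx : x = 0
  · rw [hx, Algebra.norm_zero, MulChar.map_zero, MulChar.map_zero]
  · lift x to Lˣ using isUnit_iff_ne_zero.2 hx
    simp [normLift]

variable (k L) in
/-- `normLift` as a homomorphism between the groups of multiplicative characters. -/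
def normLiftHom : MulChar k Qbar →* MulChar L Qbar where
  toFun := normLift L
  map_one' := by
    ext x
    rw [normLift_apply, MulChar.one_apply_coe, MulChar.one_apply (x.isUnit.map (Algebra.norm k))]
  map_mul' η θ := by
    ext x
    simp only [MulChar.mul_apply, normLift_apply]

lemma normLift_one : normLift L (1 : MulChar k Qbar) = 1 := map_one (normLiftHom k L)

lemma normLift_pow (η : MulChar k Qbar) (m : ℕ) : normLift L (η ^ m) = normLift L η ^ m :=
  map_pow (normLiftHom k L) η m

lemma normLift_prod {ι : Type*} (s : Finset ι) (η : ι → MulChar k Qbar) :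
    normLift L (∏ i ∈ s, η i) = ∏ i ∈ s, normLift L (η i) :=
  map_prod (normLiftHom k L) η s

lemma normLift_zpow (η : MulChar k Qbar) (m : ℤ) : normLift L (η ^ m) = normLift L η ^ m :=
  map_zpow (normLiftHom k L) η m

lemma normLift_eq_one_iff [Finite L] (η : MulChar k Qbar) : normLift L η = 1 ↔ η = 1 := by
  refine ⟨fun h => ?_, fun h => h ▸ normLift_one⟩
  have : Finite k := Finite.of_injective _ (algebraMap k L).injective
  ext x
  obtain ⟨y, rfl⟩ := FiniteField.unitsMap_norm_surjective k L x
  have hy : normLift L η y = 1 := by rw [h, MulChar.one_apply_coe]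
  rw [normLift_apply] at hy
  rw [MulChar.one_apply_coe]
  exact hy

lemma compTrace_ne_one [Algebra.IsSeparable k L] {R : Type*} [CommMonoid R]
    {ψ : AddChar k R} (hψ : ψ ≠ 1) :
    ψ.compAddMonoidHom (Algebra.trace k L).toAddMonoidHom ≠ 1 := by
  obtain ⟨t, ht⟩ := AddChar.ne_one_iff.1 hψ
  obtain ⟨x, rfl⟩ := Algebra.trace_surjective k L t
  exact AddChar.ne_one_iff.2 ⟨x, ht⟩

variable [Fintype k] [Fintype L]

lemma gaussG_normLift (χ : MulChar k Qbar) {ψ : AddChar k Qbar} (hψ : ψ ≠ 1) :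
    gaussG (ψ.compAddMonoidHom (Algebra.trace k L).toAddMonoidHom) (normLift L χ) =
      gaussG ψ χ ^ Module.finrank k L := by
  rw [gaussG, gaussG, ← neg_sum_norm_mul_trace χ hψ, gaussSum]
  simp only [normLift_apply]
  rfl

lemma gaussGCirc_normLift (χ : MulChar k Qbar) {ψ : AddChar k Qbar} (hψ : ψ ≠ 1) :
    gaussGCirc (ψ.compAddMonoidHom (Algebra.trace k L).toAddMonoidHom) (normLift L χ) =
      gaussGCirc ψ χ ^ Module.finrank k L := by
  rw [gaussGCirc, gaussGCirc, gaussG_normLift χ hψ, mul_pow]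
  have hL := normLift_eq_one_iff (L := L) χ
  by_cases h : χ = 1
  · rw [if_pos (hL.2 h), if_pos h, Module.card_eq_pow_finrank (K := k) (V := L), Nat.cast_pow]
  · rw [if_neg (mt hL.1 h), if_neg h, one_pow]

variable (L) in
theorem jacobiJ_normLift {n : ℕ} {η : Fin (n + 1) → MulChar k Qbar} (hη : ∃ i, η i ≠ 1) :
    jacobiJ (fun i => normLift L (η i)) = jacobiJ η ^ Module.finrank k L := by
  obtain ⟨ψ, hψ⟩ := exists_addChar_ne_one k
  have hηL : ∃ i, normLift L (η i) ≠ 1 := hη.imp fun i hi => by rwa [Ne, normLift_eq_one_iff]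
  have h := jacobiJ_mul_gaussGCirc hψ hη
  have hL := jacobiJ_mul_gaussGCirc (compTrace_ne_one (L := L) hψ) hηL
  simp only [← normLift_prod, gaussG_normLift _ hψ, gaussGCirc_normLift _ hψ, Finset.prod_pow,
    ← h, mul_pow] at hL
  exact mul_right_cancel₀ (pow_ne_zero _ (gaussGCirc_ne_zero hψ _)) hL

end NormLift

section PowerResidues

variable {k : Type*} [Field k]

lemma restrictRoots_zpow (φ : MulChar k Qbar) (d : ℕ) (m : ℤ) :
    restrictRoots (φ ^ m) d = restrictRoots φ d ^ m := by
  ext1 g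
  exact DFunLike.congr_fun (map_zpow MulChar.mulEquivToUnitHom φ m) (g : kˣ)

lemma restrictRoots_zpow_eq_one (φ : MulChar k Qbar) {d : ℕ} {m : ℤ} (hm : (d : ℤ) ∣ m) :
    restrictRoots φ d ^ m = 1 := by
  obtain ⟨e, rfl⟩ := hm
  ext1 g
  have hg : g ^ d = 1 := Subtype.ext ((mem_rootsOfUnity d (g : kˣ)).1 g.2)
  rw [MonoidHom.zpow_apply, ← map_zpow, zpow_mul, zpow_natCast, hg, one_zpow, map_one,
    MonoidHom.one_apply]

variable [Fintype k] {d : ℕ}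

lemma charD_zpow (φ : MulChar k Qbar) (d : ℕ) (m : ℤ) : charD (φ ^ m) d = charD φ d ^ m := by
  rw [charD, charD, ← zpow_natCast, ← zpow_natCast, zpow_comm]

lemma charD_zpow_eq_one_iff {φ : MulChar k Qbar} (hφ : ∀ η : MulChar k Qbar, η ∈ Subgroup.zpowers φ)
    (hd : d ∣ Fintype.card k - 1) (j : ℤ) : charD φ d ^ j = 1 ↔ (d : ℤ) ∣ j := by
  have horder : orderOf φ = Fintype.card k - 1 := by
    rw [orderOf_eq_card_of_forall_mem_zpowers hφ,
      MulChar.card_eq_card_units_of_hasEnoughRootsOfUnity, Nat.card_units,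
      Nat.card_eq_fintype_card]
  have hne : Fintype.card k - 1 ≠ 0 := (Nat.sub_pos_of_lt Fintype.one_lt_card).ne'
  rw [← orderOf_dvd_iff_zpow_eq_one, charD, orderOf_pow_of_dvd, horder, Nat.div_div_self hd hne]
  · exact (Nat.div_pos (Nat.le_of_dvd hne.bot_lt hd) (Nat.pos_of_dvd_of_pos hd hne.bot_lt)).ne'
  · rw [horder]
    exact Nat.div_dvd_of_dvd hd

lemma natCard_rootsOfUnity (hd : d ∣ Fintype.card k - 1) : Nat.card (rootsOfUnity d k) = d := by
  have hker : rootsOfUnity d k = (powMonoidHom d : kˣ →* kˣ).ker := by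
    ext
    rfl
  rw [hker, IsCyclic.card_powMonoidHom_ker, Nat.card_units, Nat.card_eq_fintype_card,
    Nat.gcd_eq_right hd]

/-- The `d`-th power residue symbol `u^((q - 1) / d)` of a finite field with `q` elements. -/
def powerResidue (hd : d ∣ Fintype.card k - 1) (u : kˣ) : rootsOfUnity d k :=
  ⟨u ^ ((Fintype.card k - 1) / d), by
    rw [mem_rootsOfUnity, ← pow_mul, Nat.div_mul_cancel hd, ← Nat.card_eq_fintype_card,
      ← Nat.card_units, pow_card_eq_one']⟩

lemma restrictRoots_powerResidue (φ : MulChar k Qbar) (hd : d ∣ Fintype.card k - 1) (u : kˣ) :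
    (restrictRoots φ d (powerResidue hd u) : Qbar) = charD φ d u := by
  rw [charD, MulChar.pow_apply_coe, ← map_pow, ← Units.val_pow_eq_pow_val]
  exact MulChar.coe_toUnitHom φ _

lemma charD_eq_one_of_restrictRoots_eq_one {φ : MulChar k Qbar} (hd : d ∣ Fintype.card k - 1)
    (h : restrictRoots φ d = 1) : charD φ d = 1 := by
  ext u
  rw [← restrictRoots_powerResidue φ hd, h, MonoidHom.one_apply, Units.val_one,
    MulChar.one_apply_coe]

end PowerResidues

section TwistedRoots

variable {k : Type*} [Field k] {kbar : Type*} [Field kbar] [Algebra k kbar]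
  (K : IntermediateField k kbar)

lemma coe_aeval {σ : Type*} (f : MvPolynomial σ k) (x : σ → K) :
    ((MvPolynomial.aeval x f : K) : kbar) = MvPolynomial.aeval (fun i => (x i : kbar)) f :=
  MvPolynomial.comp_aeval_apply x K.val f

variable [Fintype K]

lemma mem_iff_pow_card_eq (x : kbar) : x ∈ K ↔ x ^ Fintype.card K = x := by
  refine ⟨fun hx => congrArg Subtype.val (FiniteField.pow_card (⟨x, hx⟩ : K)), fun hx => ?_⟩
  have hcard : 1 < Fintype.card K := Fintype.one_lt_card
  have hsplits : (Polynomial.X ^ Fintype.card K - Polynomial.X : Polynomial K).Splits := by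
    rw [Polynomial.splits_iff_card_roots, FiniteField.roots_X_pow_card_sub_X,
      FiniteField.X_pow_card_sub_X_natDegree_eq _ hcard]
    rfl
  exact hsplits.mem_subfield_of_isRoot K.toSubfield
    (FiniteField.X_pow_card_sub_X_ne_zero _ hcard) (by simp [hx])

variable {d : ℕ}

/-- The `d`-th roots of `u ∈ K` on which the Frobenius of `K` acts as multiplication by `g`. -/
def twistedRoots (g : rootsOfUnity d k) (u : K) : Set kbar :=
  {y | y ^ d = u ∧ y ^ Fintype.card K = algebraMap k kbar ((g : kˣ) : k) * y}

variable {K} [NeZero d]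

lemma finite_twistedRoots (g : rootsOfUnity d k) (u : K) : Finite (twistedRoots K g u) :=
  ((Multiset.finite_toSet (Polynomial.nthRoots d (u : kbar))).subset fun _ hy =>
    (Polynomial.mem_nthRoots (NeZero.pos d)).2 hy.1).to_subtype

lemma natCard_twistedRoots_zero (g : rootsOfUnity d k) :
    Nat.card (twistedRoots K g 0) = 1 := by
  have hzero : twistedRoots K g 0 = {0} := by
    ext y
    simp only [twistedRoots, ZeroMemClass.coe_zero, Set.mem_ofPred_eq, Set.mem_singleton_iff,
      pow_eq_zero_iff (NeZero.ne d)]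
    refine ⟨And.left, ?_⟩
    rintro rfl
    simp
  rw [hzero, Nat.card_unique]

end TwistedRoots

lemma natCard_pow_eq {L : Type*} [Field L] [IsAlgClosed L] {d : ℕ} [NeZero d] {ζ : L}
    (hζ : IsPrimitiveRoot ζ d) {u : L} (hu : u ≠ 0) :
    Nat.card {y : L // y ^ d = u} = d := by
  classical
  have hcard := hζ.card_nthRoots u
  rw [if_pos (IsAlgClosed.exists_pow_nat_eq u (NeZero.pos d)),
    ← Multiset.toFinset_card_of_nodup (hζ.nthRoots_nodup hu)] at hcard
  refine (Nat.subtype_card _ fun y => ?_).trans hcard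
  rw [Multiset.mem_toFinset, Polynomial.mem_nthRoots (NeZero.pos d)]

section Points

variable {k : Type*} [Field k] [Fintype k] {kbar : Type*} [Field kbar] [Algebra k kbar]
  {σ : Type*} {d : ℕ}

lemma CoverPoints.frob_iterate_val {f : MvPolynomial σ k} (P : CoverPoints kbar d f) (r : ℕ) :
    (CoverPoints.frob^[r] P).1 =
      (fun i => P.1.1 i ^ Fintype.card k ^ r, P.1.2 ^ Fintype.card k ^ r) := by
  induction r with
  | zero => simp
  | succ r ih =>
    rw [Function.iterate_succ_apply', CoverPoints.frob]
    simp only [ih, ← pow_mul, ← pow_succ]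

variable {K : IntermediateField k kbar} [Fintype K]

lemma CoverPoints.frob_iterate_eq_smul_iff {f : MvPolynomial σ k} {r : ℕ}
    (hr : Module.finrank k K = r) (g : rootsOfUnity d k) (P : CoverPoints kbar d f) :
    CoverPoints.frob^[r] P = g • P ↔ (∀ i, P.1.1 i ∈ K) ∧
      P.1.2 ^ Fintype.card K = algebraMap k kbar ((g : kˣ) : k) * P.1.2 := by
  rw [forall_congr' fun i => mem_iff_pow_card_eq K (P.1.1 i),
    Module.card_eq_pow_finrank (K := k), hr]
  refine Subtype.ext_iff.trans ?_
  rw [P.frob_iterate_val]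
  exact Prod.ext_iff.trans (and_congr_left' funext_iff)

/-- The points of `y^d = f(x)` on which the `r`-th power of Frobenius acts as the root of unity `g`
have their coordinates `x` in the extension `K` of degree `r`. -/
def twistedPointsEquiv (f : MvPolynomial σ k) {r : ℕ} (hr : Module.finrank k K = r)
    (g : rootsOfUnity d k) :
    {P : CoverPoints kbar d f // CoverPoints.frob^[r] P = g • P} ≃
      Σ x : σ → K, twistedRoots K g (MvPolynomial.aeval x f) where
  toFun P :=
    have hP := (CoverPoints.frob_iterate_eq_smul_iff hr g P.1).1 P.2
    let x (i : σ) : K := ⟨P.1.1.1 i, hP.1 i⟩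
    ⟨x, P.1.1.2, P.1.2.trans (coe_aeval K f x).symm, hP.2⟩
  invFun Q :=
    ⟨⟨(fun i => Q.1 i, Q.2.1), Q.2.2.1.trans (coe_aeval K f Q.1)⟩,
      (CoverPoints.frob_iterate_eq_smul_iff hr g _).2 ⟨fun i => (Q.1 i).2, Q.2.2.2⟩⟩
  left_inv _ := rfl
  right_inv _ := rfl

variable [NeZero d]

lemma twistedCount_eq_sum [Fintype (rootsOfUnity d k)] [Fintype σ] [DecidableEq σ]
    (hd : d ∣ Fintype.card k - 1)
    (f : MvPolynomial σ k) (χ : rootsOfUnity d k →* Qbarˣ) {r : ℕ+}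
    (hr : Module.finrank k K = r) :
    twistedCount (CoverPoints.frob : CoverPoints kbar d f → _) χ r =
      1 / (d : Qbar) * ∑ x : σ → K, ∑ g : rootsOfUnity d k,
        (χ g : Qbar) * Nat.card (twistedRoots K g (MvPolynomial.aeval x f)) := by
  rw [twistedCount, finsum_eq_sum_of_fintype, Finset.sum_comm, natCard_rootsOfUnity hd]
  congr 1
  refine Finset.sum_congr rfl fun g _ => ?_
  have (x : σ → K) := finite_twistedRoots g (MvPolynomial.aeval x f)
  rw [Nat.card_congr (twistedPointsEquiv f hr g), Nat.card_sigma, Nat.cast_sum, Finset.mul_sum]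

lemma pow_card_eq_powerResidue_mul (hd : d ∣ Fintype.card k - 1) {u : Kˣ} {y : kbar}
    (hy : y ^ d = (u : K)) :
    y ^ Fintype.card K =
      algebraMap k kbar (powerResidue hd (Units.map (Algebra.norm k) u) : kˣ) * y := by
  obtain ⟨e, he⟩ := hd
  obtain ⟨e', he'⟩ : Fintype.card k - 1 ∣ Fintype.card K - 1 := by
    rw [Module.card_eq_pow_finrank (K := k) (V := K)]
    simpa using Nat.sub_dvd_pow_sub_pow (Fintype.card k) 1 (Module.finrank k K)
  have hpos : 0 < Fintype.card k - 1 := Nat.sub_pos_of_lt Fintype.one_lt_card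
  have hnorm : algebraMap k kbar (Algebra.norm k (u : K)) = (y ^ d) ^ e' := by
    rw [hy, IsScalarTower.algebraMap_apply k K kbar, FiniteField.algebraMap_norm_eq_pow,
      Nat.card_eq_fintype_card, Nat.card_eq_fintype_card, he', Nat.mul_div_cancel_left _ hpos,
      map_pow]
    rfl
  have hexp : y ^ (Fintype.card K - 1) = ((y ^ d) ^ e') ^ ((Fintype.card k - 1) / d) := by
    rw [he', he, Nat.mul_div_cancel_left _ (NeZero.pos d), ← pow_mul, ← pow_mul, mul_right_comm,
      mul_assoc]
  rw [← Nat.sub_add_cancel (Fintype.card_pos (α := K)), pow_succ, hexp, ← hnorm, ← map_pow]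
  rfl

variable [IsAlgClosed kbar]

open Classical in
lemma natCard_twistedRoots_unit (hd : d ∣ Fintype.card k - 1) (u : Kˣ) (g : rootsOfUnity d k) :
    Nat.card (twistedRoots K g u) =
      if g = powerResidue hd (Units.map (Algebra.norm k) u) then d else 0 := by
  have hu : ((u : K) : kbar) ≠ 0 := by simp
  have hfrob {y : kbar} (hy : y ^ d = (u : K)) :
      y ^ Fintype.card K = algebraMap k kbar ((g : kˣ) : k) * y ↔
        g = powerResidue hd (Units.map (Algebra.norm k) u) := by
    have hy0 : y ≠ 0 := by
      rintro rfl
      exact hu (by rw [← hy, zero_pow (NeZero.ne d)])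
    rw [pow_card_eq_powerResidue_mul hd hy, mul_left_inj' hy0, (algebraMap k kbar).injective.eq_iff,
      Units.val_inj, Subtype.val_inj, eq_comm]
  split_ifs with hg
  · obtain ⟨ζ, hζ⟩ := card_rootsOfUnity_eq_iff_exists_isPrimitiveRoot.1 (natCard_rootsOfUnity hd)
    have hall (y : kbar) : y ∈ twistedRoots K g u ↔ y ^ d = (u : K) :=
      and_iff_left_of_imp fun hy => (hfrob hy).2 hg
    exact (Nat.card_congr (Equiv.subtypeEquivRight hall)).trans
      (natCard_pow_eq (hζ.map_of_injective (algebraMap k kbar).injective) hu)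
  · rw [Nat.card_eq_zero]
    exact .inl ⟨fun y => hg ((hfrob y.2.1).1 y.2.2)⟩

lemma sum_mul_natCard_twistedRoots_unit [Fintype (rootsOfUnity d k)] (hd : d ∣ Fintype.card k - 1)
    (χ : rootsOfUnity d k →* Qbarˣ) (u : Kˣ) :
    ∑ g : rootsOfUnity d k, (χ g : Qbar) * Nat.card (twistedRoots K g u) =
      d * χ (powerResidue hd (Units.map (Algebra.norm k) u)) := by
  simp [natCard_twistedRoots_unit hd, mul_comm]

variable [Fintype σ]

lemma twistedCount_one {K : IntermediateField k kbar} (hd : d ∣ Fintype.card k - 1)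
    (f : MvPolynomial σ k) {r : ℕ+} (hr : Module.finrank k K = r) :
    twistedCount (CoverPoints.frob : CoverPoints kbar d f → _)
      (1 : rootsOfUnity d k →* Qbarˣ) r = ((Fintype.card k : Qbar) ^ Fintype.card σ) ^ (r : ℕ) := by
  classical
  have : FiniteDimensional k K := FiniteDimensional.of_finrank_pos (hr ▸ r.pos)
  have : Finite K := Module.finite_of_finite k
  have := Fintype.ofFinite K
  have := Fintype.ofFinite (rootsOfUnity d k)
  have hd0 : (d : Qbar) ≠ 0 := NeZero.ne _
  have hfiber (u : K) : ∑ g : rootsOfUnity d k, ((1 : rootsOfUnity d k →* Qbarˣ) g : Qbar) *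
      Nat.card (twistedRoots K g u) = d := by
    obtain rfl | hu := eq_or_ne u 0
    · simp only [natCard_twistedRoots_zero, MonoidHom.one_apply, Units.val_one, Nat.cast_one,
        mul_one, Finset.sum_const, Finset.card_univ, nsmul_eq_mul]
      rw [← Nat.card_eq_fintype_card, natCard_rootsOfUnity hd]
    · lift u to Kˣ using hu.isUnit
      rw [sum_mul_natCard_twistedRoots_unit hd, MonoidHom.one_apply, Units.val_one, mul_one]
  rw [twistedCount_eq_sum hd f 1 hr]
  simp only [hfiber, Finset.sum_const, Finset.card_univ, nsmul_eq_mul, Fintype.card_fun]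
  rw [mul_left_comm, one_div_mul_cancel hd0, mul_one,
    Module.card_eq_pow_finrank (K := k) (V := K), hr, ← pow_mul, ← pow_mul, mul_comm, Nat.cast_pow]

lemma twistedCount_restrictRoots [DecidableEq σ] (hd : d ∣ Fintype.card k - 1)
    (f : MvPolynomial σ k) {φ : MulChar k Qbar} (hφ : restrictRoots φ d ≠ 1) {r : ℕ+}
    (hr : Module.finrank k K = r) :
    twistedCount (CoverPoints.frob : CoverPoints kbar d f → _) (restrictRoots φ d) r =
      ∑ x : σ → K, normLift K (charD φ d) (MvPolynomial.aeval x f) := by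
  have := Fintype.ofFinite (rootsOfUnity d k)
  have hd0 : (d : Qbar) ≠ 0 := NeZero.ne _
  have hsum : ∑ g : rootsOfUnity d k, (restrictRoots φ d g : Qbar) = 0 := by
    refine sum_hom_units_eq_zero ((Units.coeHom Qbar).comp (restrictRoots φ d)) fun h => hφ ?_
    ext1 g
    exact Units.ext (DFunLike.congr_fun h g)
  have hfiber (u : K) : ∑ g : rootsOfUnity d k, (restrictRoots φ d g : Qbar) *
      Nat.card (twistedRoots K g u) = d * normLift K (charD φ d) u := by
    obtain rfl | hu := eq_or_ne u 0
    · simp only [natCard_twistedRoots_zero, Nat.cast_one, mul_one, hsum, MulChar.map_zero, mul_zero]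
    · lift u to Kˣ using hu.isUnit
      rw [sum_mul_natCard_twistedRoots_unit hd, restrictRoots_powerResidue, normLift_apply,
        Units.coe_map]
  rw [twistedCount_eq_sum hd f _ hr]
  simp only [hfiber]
  rw [← Finset.mul_sum, ← mul_assoc, one_div_mul_cancel hd0, one_mul]

end Points

section Evaluation

variable {k : Type*} [Field k] {F : Type*} [Field F] [Algebra k F]

lemma mulChar_apply_pow (η : MulChar F Qbar) {e : ℕ} (he : e ≠ 0) (u : F) :
    η (u ^ e) = (η ^ e) u := by
  rw [MulChar.pow_apply' _ he, map_pow]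

lemma apply_aeval_polyCD (η : MulChar F Qbar) {n : ℕ} {a c : ℕ} {b : Fin n → ℕ}
    (ha : a ≠ 0) (hc : c ≠ 0) (hb : ∀ i, b i ≠ 0) (l : Fin n → k) (x : Fin 1 → F) :
    η (MvPolynomial.aeval x (polyCD a c b l)) =
      (∏ i, (η ^ b i) (1 - algebraMap k F (l i) * x 0)) * (η ^ a) (x 0) * (η ^ c) (1 - x 0) := by
  simp only [polyCD, map_mul, map_prod, map_pow (MvPolynomial.aeval x), map_sub, map_one,
    MvPolynomial.aeval_X, MvPolynomial.aeval_C, mulChar_apply_pow η ha, mulChar_apply_pow η hc,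
    mulChar_apply_pow η (hb _)]

lemma apply_aeval_polySD (η : MulChar F Qbar) {n : ℕ} {a c : ℕ} {b : Fin n → ℕ}
    (ha : a ≠ 0) (hc : c ≠ 0) (hb : ∀ i, b i ≠ 0) (l : Fin n → k) (x : Fin n → F) :
    η (MvPolynomial.aeval x (polySD a c b l)) =
      (η ^ a) (1 - ∑ i, algebraMap k F (l i) * x i) * (∏ i, (η ^ b i) (x i)) *
        (η ^ c) (1 - ∑ i, x i) := by
  simp only [polySD, map_mul, map_prod, map_sum, map_pow (MvPolynomial.aeval x), map_sub, map_one,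
    MvPolynomial.aeval_X, MvPolynomial.aeval_C, mulChar_apply_pow η ha, mulChar_apply_pow η hc,
    mulChar_apply_pow η (hb _)]

end Evaluation

section LFunctions

variable {k : Type*} [Field k] [Fintype k]

lemma jacobiJ_pair_normLift (L : Type*) [Field L] [Fintype L] [Algebra k L] (α : MulChar k Qbar)
    {θ : MulChar k Qbar} (hθ : θ ≠ 1) :
    jacobiJ ![normLift L α, normLift L θ] = jacobiJ ![α, θ] ^ Module.finrank k L := by
  rw [← jacobiJ_normLift L (η := ![α, θ]) ⟨1, hθ⟩]
  congr 1
  funext i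
  fin_cases i <;> rfl

lemma jacobiJ_snoc_normLift (L : Type*) [Field L] [Fintype L] [Algebra k L] {n : ℕ}
    (β : Fin n → MulChar k Qbar) {θ : MulChar k Qbar} (hθ : θ ≠ 1) :
    jacobiJ (Fin.snoc (α := fun _ => MulChar L Qbar) (fun i => normLift L (β i)) (normLift L θ)) =
      jacobiJ (Fin.snoc (α := fun _ => MulChar k Qbar) β θ) ^ Module.finrank k L := by
  rw [← jacobiJ_normLift L ⟨Fin.last n, by rwa [Fin.snoc_last]⟩]
  congr 1
  funext i
  refine Fin.lastCases ?_ (fun i => ?_) i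
  · simp only [Fin.snoc_last]
  · simp only [Fin.snoc_castSucc]

variable {kbar : Type*} [Field kbar] [Algebra k kbar] [IsAlgClosed kbar] {d : ℕ} [NeZero d]
  {φ : MulChar k Qbar} {n a c : ℕ} {b : Fin n → ℕ} {l : Fin n → k}

section Counts

variable {K : IntermediateField k kbar} [Fintype K] {r : ℕ+} {ψ : AddChar K Qbar}

lemma twistedCount_polyCD (hr : Module.finrank k K = r) (hψ : ψ ≠ 1)
    (hd : d ∣ Fintype.card k - 1) (ha : a ≠ 0) (hc : charD φ d ^ c ≠ 1)
    (hb : ∀ i, charD φ d ^ b i ≠ 1) (hl : ∀ i, l i ≠ 0) :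
    twistedCount (CoverPoints.frob : CoverPoints kbar d (polyCD a c b l) → _)
        (restrictRoots φ d) r =
      -(jacobiJ ![charD φ d ^ a, charD φ d ^ c] ^ (r : ℕ) *
        lauricellaFD ψ (normLift K (charD φ d) ^ a) (fun i => (normLift K (charD φ d))⁻¹ ^ b i)
          (normLift K (charD φ d) ^ (c + a)) (fun i => algebraMap k K (l i))) := by
  have hne {e : ℕ} (he : charD φ d ^ e ≠ 1) : e ≠ 0 := fun h => he (h ▸ pow_zero _)
  have hneK {e : ℕ} (he : charD φ d ^ e ≠ 1) : normLift K (charD φ d) ^ e ≠ 1 := by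
    rwa [← normLift_pow, Ne, normLift_eq_one_iff]
  have hχ : restrictRoots φ d ≠ 1 := fun h =>
    hc (by rw [charD_eq_one_of_restrictRoots_eq_one hd h, one_pow])
  have hβ i : (normLift K (charD φ d))⁻¹ ^ b i ≠ 1 := by
    rw [inv_pow]
    exact inv_ne_one.2 (hneK (hb i))
  have hz i : algebraMap k K (l i) ≠ 0 := by simpa using hl i
  rw [twistedCount_restrictRoots hd _ hχ hr, ← hr, ← jacobiJ_pair_normLift K _ hc, normLift_pow,
    normLift_pow, add_comm c a, pow_add, jacobiJ_pair_mul_lauricellaFD hψ _ (hneK hc) hβ hz,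
    neg_neg, ← (Equiv.funUnique (Fin 1) K).symm.sum_comp]
  refine Finset.sum_congr rfl fun x _ => ?_
  rw [apply_aeval_polyCD _ ha (hne hc) fun i => hne (hb i)]
  simp only [inv_pow, inv_inv]
  rfl

lemma twistedCount_polySD (hr : Module.finrank k K = r) (hψ : ψ ≠ 1)
    (hd : d ∣ Fintype.card k - 1) (ha : charD φ d ^ a ≠ 1) (hc : charD φ d ^ c ≠ 1)
    (hb : ∀ i, b i ≠ 0) (hl : ∀ i, l i ≠ 0) :
    twistedCount (CoverPoints.frob : CoverPoints kbar d (polySD a c b l) → _)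
        (restrictRoots φ d) r =
      (-1) ^ n * (jacobiJ (Fin.snoc (α := fun _ => MulChar k Qbar)
          (fun i => charD φ d ^ b i) (charD φ d ^ c)) ^ (r : ℕ) *
        lauricellaFD ψ ((normLift K (charD φ d))⁻¹ ^ a) (fun i => normLift K (charD φ d) ^ b i)
          (normLift K (charD φ d) ^ ((∑ i, b i) + c)) (fun i => algebraMap k K (l i))) := by
  have hne {e : ℕ} (he : charD φ d ^ e ≠ 1) : e ≠ 0 := fun h => he (h ▸ pow_zero _)
  have hneK {e : ℕ} (he : charD φ d ^ e ≠ 1) : normLift K (charD φ d) ^ e ≠ 1 := by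
    rwa [← normLift_pow, Ne, normLift_eq_one_iff]
  have hχ : restrictRoots φ d ≠ 1 := fun h =>
    hc (by rw [charD_eq_one_of_restrictRoots_eq_one hd h, one_pow])
  have hz i : algebraMap k K (l i) ≠ 0 := by simpa using hl i
  rw [twistedCount_restrictRoots hd _ hχ hr, ← hr, ← jacobiJ_snoc_normLift K _ hc]
  simp only [normLift_pow]
  rw [pow_add, ← Finset.prod_pow_eq_pow_sum, inv_pow,
    jacobiJ_snoc_mul_lauricellaFD hψ (inv_ne_one.2 (hneK ha)) (hneK hc) _ hz,
    ← mul_assoc, ← mul_pow, neg_one_mul, neg_neg, one_pow, one_mul, inv_inv]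
  exact Finset.sum_congr rfl fun x _ => apply_aeval_polySD _ (hne ha) (hne hc) hb l x

end Counts

variable {K : ℕ+ → IntermediateField k kbar}

lemma artinL_one {σ : Type*} [Fintype σ] (hK : ∀ r, Module.finrank k (K r) = r)
    (hd : d ∣ Fintype.card k - 1) (f : MvPolynomial σ k) :
    artinL (CoverPoints.frob : CoverPoints kbar d f → _) (1 : rootsOfUnity d k →* Qbarˣ) =
      (1 - PowerSeries.C ((Fintype.card k : Qbar) ^ Fintype.card σ) * PowerSeries.X)⁻¹ := by
  rw [artinL, ← expSeries_pow]
  exact congrArg expSeries (funext fun r => twistedCount_one hd f (hK r))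

variable [∀ r, Fintype (K r)] {ψ : ∀ r, AddChar (K r) Qbar}

lemma artinLCD_restrictRoots (hK : ∀ r, Module.finrank k (K r) = r) (hψ : ∀ r, ψ r ≠ 1)
    (hd : d ∣ Fintype.card k - 1) (ha : a ≠ 0) (hc : charD φ d ^ c ≠ 1)
    (hb : ∀ i, charD φ d ^ b i ≠ 1) (hl : ∀ i, l i ≠ 0) :
    artinLCD kbar d a c b l (restrictRoots φ d) =
      (expSeries fun r => jacobiJ ![charD φ d ^ a, charD φ d ^ c] ^ (r : ℕ) *
        lauricellaFD (ψ r) (normLift (K r) (charD φ d) ^ a)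
          (fun i => (normLift (K r) (charD φ d))⁻¹ ^ b i)
          (normLift (K r) (charD φ d) ^ (c + a)) (fun i => algebraMap k (K r) (l i)))⁻¹ := by
  rw [← expSeries_neg]
  exact congrArg expSeries (funext fun r => twistedCount_polyCD (hK r) (hψ r) hd ha hc hb hl)

lemma artinLSD_restrictRoots (hK : ∀ r, Module.finrank k (K r) = r) (hψ : ∀ r, ψ r ≠ 1)
    (hd : d ∣ Fintype.card k - 1) (ha : charD φ d ^ a ≠ 1) (hc : charD φ d ^ c ≠ 1)
    (hb : ∀ i, b i ≠ 0) (hl : ∀ i, l i ≠ 0) :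
    artinLSD kbar d a c b l (restrictRoots φ d) =
      signPow (expSeries fun r => jacobiJ (Fin.snoc (α := fun _ => MulChar k Qbar)
          (fun i => charD φ d ^ b i) (charD φ d ^ c)) ^ (r : ℕ) *
        lauricellaFD (ψ r) ((normLift (K r) (charD φ d))⁻¹ ^ a)
          (fun i => normLift (K r) (charD φ d) ^ b i)
          (normLift (K r) (charD φ d) ^ ((∑ i, b i) + c)) (fun i => algebraMap k (K r) (l i)))
        n := by
  rw [signPow_expSeries]
  exact congrArg expSeries (funext fun r => twistedCount_polySD (hK r) (hψ r) hd ha hc hb hl)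

end LFunctions

theorem mainTheorem12_general
    {k : Type*} [Field k] [Fintype k]
    {kbar : Type*} [Field kbar] [Algebra k kbar] [IsAlgClosed kbar]
    (K : ℕ+ → IntermediateField k kbar) [∀ r, Fintype (K r)]
    (hK : ∀ r, Module.finrank k (K r) = r)
    (ψ : ∀ r, AddChar (K r) Qbar) (hψ : ∀ r, ψ r ≠ 1)
    {n : ℕ} (d a c : ℕ) [NeZero d] (b : Fin n → ℕ)
    (l : Fin n → k) (hl : ∀ i, l i ≠ 0)
    (hd : d ∣ Fintype.card k - 1)
    (φ : MulChar k Qbar) (m : ℤ) :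
    (restrictRoots φ d ^ m = 1 →
      artinLCD kbar d a c b l (restrictRoots φ d ^ m) =
        (1 - PowerSeries.C (Fintype.card k : Qbar) * PowerSeries.X)⁻¹ ∧
      artinLSD kbar d a c b l (restrictRoots φ d ^ m) =
        (1 - PowerSeries.C ((Fintype.card k : Qbar) ^ n) * PowerSeries.X)⁻¹) ∧
    (a ≠ 0 → charD φ d ^ (m * c) ≠ 1 → (∀ i, charD φ d ^ (m * b i) ≠ 1) →
      artinLCD kbar d a c b l (restrictRoots φ d ^ m) =
        (expSeries fun r =>
          jacobiJ ![charD φ d ^ (m * a), charD φ d ^ (m * c)] ^ (r : ℕ) *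
            lauricellaFD (ψ r)
              (normLift (K r) (charD φ d) ^ (m * a))
              (fun i => (normLift (K r) (charD φ d))⁻¹ ^ (m * b i))
              (normLift (K r) (charD φ d) ^ (m * (c + a)))
              (fun i => algebraMap k (K r) (l i)))⁻¹) ∧
    (charD φ d ^ (m * a) ≠ 1 → charD φ d ^ (m * c) ≠ 1 → (∀ i, b i ≠ 0) →
      artinLSD kbar d a c b l (restrictRoots φ d ^ m) =
        signPow
          (expSeries fun r =>
            jacobiJ (Fin.snoc (α := fun _ => MulChar k Qbar)
                (fun i => charD φ d ^ (m * b i)) (charD φ d ^ (m * c))) ^ (r : ℕ) *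
              lauricellaFD (ψ r)
                ((normLift (K r) (charD φ d))⁻¹ ^ (m * a))
                (fun i => normLift (K r) (charD φ d) ^ (m * b i))
                (normLift (K r) (charD φ d) ^ (m * ((∑ i, (b i : ℤ)) + c)))
                (fun i => algebraMap k (K r) (l i)))
          n) := by
  refine ⟨fun hm => ?_, fun ha hc hb => ?_, fun ha hc hb => ?_⟩
  · rw [hm, artinLCD, artinLSD, artinL_one hK hd, artinL_one hK hd, Fintype.card_fin, pow_one,
      Fintype.card_fin]
    exact ⟨rfl, rfl⟩
  · simp only [zpow_mul, zpow_natCast, ← charD_zpow] at hc hb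
    rw [← restrictRoots_zpow, artinLCD_restrictRoots hK hψ hd ha hc hb hl]
    simp only [charD_zpow, normLift_zpow, ← inv_zpow, zpow_mul, ← Nat.cast_add, zpow_natCast]
  · simp only [zpow_mul, zpow_natCast, ← charD_zpow] at ha hc
    rw [← restrictRoots_zpow, artinLSD_restrictRoots hK hψ hd ha hc hb hl]
    simp only [charD_zpow, normLift_zpow, ← inv_zpow, zpow_mul, ← Nat.cast_sum, ← Nat.cast_add,
      zpow_natCast]

end

theorem mainTheorem12
    {k : Type*} [Field k] [Fintype k]
    {kbar : Type*} [Field kbar] [Algebra k kbar] [IsAlgClosure k kbar]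
    -- `K r` is the extension of `k` of degree `r` in `kbar`, with a nontrivial additive character
    (K : ℕ+ → IntermediateField k kbar) [∀ r, Fintype (K r)]
    (hK : ∀ r, Module.finrank k (K r) = r)
    (ψ : ∀ r, AddChar (K r) Qbar) (hψ : ∀ r, ψ r ≠ 1)
    {n : ℕ} (d a c : ℕ) [NeZero d] (b : Fin n → ℕ)
    (ha : 0 < a) (hc : 0 < c) (hb : ∀ i, 0 < b i)
    (l : Fin n → k) (hl : ∀ i, l i ≠ 0)
    (hd : d ∣ Fintype.card k - 1)
    (φ : MulChar k Qbar) (hφ : ∀ η : MulChar k Qbar, η ∈ Subgroup.zpowers φ)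
    -- the exponent `m` matters only modulo `d`
    (m : ℤ) :
    ((d.Coprime c ∧ ∀ i, d.Coprime (b i)) →
      ((d : ℤ) ∣ m →
        artinLCD kbar d a c b l (restrictRoots φ d ^ m) =
          (1 - PowerSeries.C (Fintype.card k : Qbar) * PowerSeries.X)⁻¹) ∧
      (¬ (d : ℤ) ∣ m →
        artinLCD kbar d a c b l (restrictRoots φ d ^ m) =
          (expSeries fun r =>
            jacobiJ ![charD φ d ^ (m * a), charD φ d ^ (m * c)] ^ (r : ℕ) *
              lauricellaFD (ψ r)
                (normLift (K r) (charD φ d) ^ (m * a))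
                (fun i => (normLift (K r) (charD φ d))⁻¹ ^ (m * b i))
                (normLift (K r) (charD φ d) ^ (m * (c + a)))
                (fun i => algebraMap k (K r) (l i)))⁻¹)) ∧
    ((d.Coprime a ∧ d.Coprime c) →
      ((d : ℤ) ∣ m →
        artinLSD kbar d a c b l (restrictRoots φ d ^ m) =
          (1 - PowerSeries.C ((Fintype.card k : Qbar) ^ n) * PowerSeries.X)⁻¹) ∧
      (¬ (d : ℤ) ∣ m →
        artinLSD kbar d a c b l (restrictRoots φ d ^ m) =
          signPow
            (expSeries fun r =>
              jacobiJ (Fin.snoc (α := fun _ => MulChar k Qbar)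
                  (fun i => charD φ d ^ (m * b i)) (charD φ d ^ (m * c))) ^ (r : ℕ) *
                lauricellaFD (ψ r)
                  ((normLift (K r) (charD φ d))⁻¹ ^ (m * a))
                  (fun i => normLift (K r) (charD φ d) ^ (m * b i))
                  (normLift (K r) (charD φ d) ^ (m * ((∑ i, (b i : ℤ)) + c)))
                  (fun i => algebraMap k (K r) (l i)))
            n)) := by
  have : IsAlgClosed kbar := IsAlgClosure.isAlgClosed k
  obtain ⟨htrivial, hC, hS⟩ := mainTheorem12_general K hK ψ hψ d a c b l hl hd φ m
  have hone (hm : (d : ℤ) ∣ m) := htrivial (restrictRoots_zpow_eq_one φ hm)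
  have hne (hm : ¬(d : ℤ) ∣ m) {e : ℕ} (he : d.Coprime e) : charD φ d ^ (m * e) ≠ 1 := fun h =>
    hm ((Nat.isCoprime_iff_coprime.2 he).dvd_of_dvd_mul_right ((charD_zpow_eq_one_iff hφ hd _).1 h))
  exact ⟨fun ⟨hdc, hdb⟩ => ⟨fun hm => (hone hm).1,
      fun hm => hC ha.ne' (hne hm hdc) fun i => hne hm (hdb i)⟩,
    fun ⟨hda, hdc⟩ => ⟨fun hm => (hone hm).2,
      fun hm => hS (hne hm hda) (hne hm hdc) fun i => (hb i).ne'⟩⟩
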